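/- Let $d\ge 1$, $s\in(0,1)$, $p\in(1,\infty)$, $p'=p/(p-1)$, and let $\Omega\subset\mathbb{R}^d$ be an open set with $0\in\Omega$. Let $f\in L^\infty(\Omega)$ satisfy $|f(x)|=O(|x|^n)$ as $|x|\to0$ (for almost every $x$) for every $n\in\mathbb{N}$, and let $V:\Omega\times\mathbb{R}\to\mathbb{R}$ be such that, for some $\varepsilon_0>0$, $n_0\in\mathbb{N}$ and $C\in\mathbb{R}$, $$|x|^{n_0}\,|V(x,t)|\le C\,|t|^{\varepsilon_0}\qquad\text{for almost every }x\in\Omega\text{ and all }t\in\mathbb{R}.$$ Let $u\in L^{p-1}_{sp}(\mathbb{R}^d)$, i.e. $u:\mathbb{R}^d\to\mathbb{R}$ is measurable with $\int_{\mathbb{R}^d}|u(x)|^{p-1}(1+|x|)^{-d-sp}\,dx<\infty$, and suppose that at least one of the following holds: (i) $p\ge2$ and $u\in C^{1,\alpha}_{\mathrm{loc}}(\Omega)$ for some $\alpha\in[0,1]$ with $\alpha>1-(1-s)p$; (ii) $u\in C^{0,\beta}_{\mathrm{loc}}(\Omega)$ for some $\beta$ with $sp'<\beta\le1$; (iii)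 $p\le2$ and $u\in C^{\lfloor\beta\rfloor,\beta-\lfloor\beta\rfloor}_{\mathrm{loc}}(\Omega)$ for some $\beta$ with $sp'<\beta<2$. Here $C^{k,\alpha}_{\mathrm{loc}}(\Omega)$ is the space of $C^k$ functions on $\Omega$ whose derivatives of order $k$ are $\alpha$-Hölder continuous on each compact subset of $\Omega$ (so $C^{k,0}_{\mathrm{loc}}(\Omega)=C^k(\Omega)$). Suppose that $u$ is a strong solution of $(-\Delta_p)^su-V(\cdot,u)=f$ in $\Omega$, i.e. for every $x\in\Omega$ the principal value $$(-\Delta_p)^su(x)=\lim_{\varepsilon\to0^+}\int_{\mathbb{R}^d\setminus B_\varepsilon(x)}\frac{|u(x)-u(y)|^{p-2}(u(x)-u(y))}{|x-y|^{d+sp}}\,dy$$ exists in $\mathbb{R}$ and $(-\Delta_p)^su(x)-V(x,u(x))=f(x)$. For $i\in\{1,\dots,d\}$ and $k\in\mathbb{N}$ put $$m_{i,k}=\int_{\mathbb{R}^d}\frac{x_i^{2k}}{|x|^{4k}}\,\frac{|u(x)|^{p-1}}{|x|^{d+sp}}\,dx\in[0,\infty].$$ If, with the conventions $1/0=+\infty$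 and $1/\infty=0$, $$\sum_{k=1}^\infty\frac1{m_{i,k}^{1/(2k)}}=+\infty\qquad\text{for every }i\in\{1,\dots,d\},$$ then $u=0$ almost everywhere on $\mathbb{R}^d$, and $u(x)=0$ for every $x\in\Omega$. -/

import Mathlib

open MeasureTheory Filter Topology
open scoped ENNReal

noncomputable section

namespace FracPLap

/-- The odd power `J_p(r) = |r|^(p-2) r`; it vanishes at `r = 0`. -/
def J (p r : ℝ) : ℝ := |r| ^ (p - 2) * r

/-- The integrand `J_p(u(x) - u(y)) / |x - y|^(d + s p)` of the fractional `p`-Laplacian. -/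
def kernelIntegrand {d : ℕ} (s p : ℝ) (u : EuclideanSpace ℝ (Fin d) → ℝ)
    (x y : EuclideanSpace ℝ (Fin d)) : ℝ :=
  J p (u x - u y) / ‖x - y‖ ^ ((d : ℝ) + s * p)

/-- The principal value integral defining `(-Δ_p)^s u (x)` exists and equals `L`: the integrals
over the complements of the balls `B_ε(x)` converge absolutely, and tend to `L` as `ε → 0+`. -/
def HasFracPLaplacianAt {d : ℕ} (s p : ℝ) (u : EuclideanSpace ℝ (Fin d) → ℝ)
    (x : EuclideanSpace ℝ (Fin d)) (L : ℝ) : Prop :=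
  (∀ ε : ℝ, 0 < ε → IntegrableOn (kernelIntegrand s p u x) (Metric.ball x ε)ᶜ volume) ∧
    Tendsto (fun ε : ℝ => ∫ y in (Metric.ball x ε)ᶜ, kernelIntegrand s p u x y)
      (𝓝[>] 0) (𝓝 L)

/-- The tail space `L^{p-1}_{sp}(ℝ^d)`: measurable `u` with
`∫ |u(x)|^(p-1) / (1 + |x|)^(d + s p) dx < ∞`. -/
def MemTailSpace {d : ℕ} (s p : ℝ) (u : EuclideanSpace ℝ (Fin d) → ℝ) : Prop :=
  AEStronglyMeasurable u volume ∧
    Integrable (fun x => |u x| ^ (p - 1) / (1 + ‖x‖) ^ ((d : ℝ) + s * p)) volume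

/-- The local Hölder space `C^{k,α}_loc(Ω)`, `0 ≤ α ≤ 1`: `u` is `C^k` in the open set `Ω`, and its
`k`-th derivative is `α`-Hölder on every compact subset of `Ω`.
For `α = 0` this is `C^k(Ω)`, for `k = 0`, `α = 1` it is local Lipschitz continuity. -/
def MemHolderLoc {d : ℕ} (k : ℕ) (α : ℝ) (u : EuclideanSpace ℝ (Fin d) → ℝ)
    (Ω : Set (EuclideanSpace ℝ (Fin d))) : Prop :=
  ContDiffOn ℝ k u Ω ∧
    ∀ K : Set (EuclideanSpace ℝ (Fin d)), IsCompact K → K ⊆ Ω →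
      ∃ C : ℝ, ∀ x ∈ K, ∀ y ∈ K,
        ‖iteratedFDeriv ℝ k u x - iteratedFDeriv ℝ k u y‖ ≤ C * ‖x - y‖ ^ α

/-- `u` is a strong solution of `(-Δ_p)^s u - V(·, u) = f` in `Ω`: the equation holds at every
point of `Ω`, the operator being given by a convergent principal value. -/
def IsStrongSolution {d : ℕ} (s p : ℝ) (V : EuclideanSpace ℝ (Fin d) → ℝ → ℝ)
    (f u : EuclideanSpace ℝ (Fin d) → ℝ) (Ω : Set (EuclideanSpace ℝ (Fin d))) : Prop :=
  MemTailSpace s p u ∧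
    ∀ x ∈ Ω, ∃ L : ℝ, HasFracPLaplacianAt s p u x L ∧ L - V x (u x) = f x

/-- The moments
`m_{i,k} = ∫ x_i^(2k) / |x|^(4k) * |u(x)|^(p-1) / |x|^(d + s p) dx`, with values in `[0, ∞]`. -/
def moment {d : ℕ} (s p : ℝ) (u : EuclideanSpace ℝ (Fin d) → ℝ) (i : Fin d) (k : ℕ) : ℝ≥0∞ :=
  ∫⁻ x : EuclideanSpace ℝ (Fin d),
    ENNReal.ofReal
      (x i ^ (2 * k) / ‖x‖ ^ (4 * k) * (|u x| ^ (p - 1) / ‖x‖ ^ ((d : ℝ) + s * p)))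

/-- The Carleman condition `∑_{k ≥ 1} m_{i,k}^(-1/(2k)) = ∞` for every coordinate `i`.
The inverse in `[0, ∞]` satisfies `1/0 = ∞` and `1/∞ = 0`. -/
def CarlemanCondition {d : ℕ} (s p : ℝ) (u : EuclideanSpace ℝ (Fin d) → ℝ) : Prop :=
  ∀ i : Fin d,
    ∑' k : ℕ, (moment s p u i (k + 1) ^ (1 / (2 * ((k : ℝ) + 1))))⁻¹ = ∞

end FracPLap

end

namespace FracPLap

/-! Write κ = d + sp, z = y/|y|² and ω(y) = J_p(u(y))/|y|^κ, so that m_{i,k} = ∫ z_i^{2k} |ω|. If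
some m_{i,k} is zero, then u = 0 a.e. at once. Otherwise Carleman's condition makes infinitely many
moments finite in each coordinate, hence all ∫ |z|^n |ω| are finite. It is then shown that every ∫
z^α ω is zero, and Carleman's condition forces ω = 0.

Flatness: finite moments say that |u|^{p-1} is integrable near 0 against every negative power of
|y|. With Hölder continuity this gives u(x) = O(|x|^N) for all N (`exists_flat`), so V(x, u(x)) +
f(x) is flat at 0 as well.

Linearisation: split the principal value at |x - y| = |x|/2. The inner part is flat, by
interpolation between regularity and flatness (`exists_near_part_le`). In the outer part J_p(u(x) -
u(y)) is replaced by -J_p(u(y)) with a flat error (`exists_far_part_le`). Since |x - y|² = |y|² (1 +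
τ) with τ = |x|²|z|² - 2 x·z, a Taylor polynomial of (1 + τ)^{-κ/2} turns what remains into a
polynomial in x that is O(|x|^N) (`exists_expansion_le`). Hence ω annihilates all Taylor
coefficients in x of (1 + τ)^{-κ/2}.

Algebra: these coefficients span all polynomials in z. The Laplacian in x maps (1 + τ)^{-r} to a
nonzero multiple of |z|² (1 + τ)^{-r-1}; combined with ∂_i this yields z_i (1 + τ)^{-r-1}, and
iteration produces every monomial at x = 0 (`KillsKernel.eq_zero`).

Moment problem: on lines parallel to the i-th axis, the n-th derivative of the Fourier transform of
the image of ω under z is at most a constant times m_{i,n}^{1/2}. Carleman's inequality and Bang's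
proof of the Denjoy–Carleman theorem make this transform vanish (`ae_eq_zero_of_carleman`). -/

/-! ### Increments of the odd power J_p -/

theorem abs_J {p : ℝ} (hp : 1 < p) (r : ℝ) : |J p r| = |r| ^ (p - 1) := by
  rcases eq_or_ne r 0 with rfl | hr
  · simp [J, Real.zero_rpow (by linarith : p - 1 ≠ 0)]
  · have h : 0 < |r| := abs_pos.2 hr
    rw [J, abs_mul, abs_of_nonneg (Real.rpow_nonneg h.le _), ← Real.rpow_add_one h.ne']
    ring_nf

theorem J_neg (p r : ℝ) : J p (-r) = -J p r := by
  simp [J]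

theorem J_of_nonneg {p r : ℝ} (hp : 1 < p) (hr : 0 ≤ r) : J p r = r ^ (p - 1) := by
  have h : 0 ≤ J p r := mul_nonneg (Real.rpow_nonneg (abs_nonneg _) _) hr
  rw [← abs_of_nonneg h, abs_J hp, abs_of_nonneg hr]

/-- An estimate for the increments of `J` on `[0, ∞)` by a symmetric monotone modulus extends to
the real line, provided that it controls pairs of opposite signs. -/
theorem abs_J_sub_J_le_of_nonneg {p : ℝ} (hp : 1 < p) {F : ℝ → ℝ → ℝ}
    (hsymm : ∀ a b, F a b = F b a) (hneg : ∀ a b, F (-a) (-b) = F a b)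
    (h₁ : ∀ a b, 0 ≤ b → b ≤ a → a ^ (p - 1) - b ^ (p - 1) ≤ F a b)
    (h₂ : ∀ a b, 0 ≤ a → 0 ≤ b → a ^ (p - 1) + b ^ (p - 1) ≤ F a (-b)) (a b : ℝ) :
    |J p a - J p b| ≤ F a b := by
  have key : ∀ a b, 0 ≤ b → b ≤ a → |J p a - J p b| ≤ F a b := fun a b hb hab => by
    rw [J_of_nonneg hp hb, J_of_nonneg hp (hb.trans hab), abs_of_nonneg]
    · exact h₁ a b hb hab
    · exact sub_nonneg.2 (Real.rpow_le_rpow hb hab (by linarith))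
  wlog hab : b ≤ a generalizing a b
  · rw [abs_sub_comm, hsymm]
    exact this b a (le_of_not_ge hab)
  rcases le_total 0 b with hb | hb
  · exact key a b hb hab
  rcases le_total a 0 with ha | ha
  · have := key (-b) (-a) (by linarith) (by linarith)
    rw [J_neg, J_neg, hneg, hsymm] at this
    calc |J p a - J p b| = |-J p b - -J p a| := by congr 1; ring
      _ ≤ _ := this
  · have := h₂ a (-b) ha (by linarith)
    rw [neg_neg] at this
    have e : J p b = -(-b) ^ (p - 1) := by
      rw [← J_of_nonneg hp (by linarith : 0 ≤ -b), J_neg, neg_neg]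
    rw [e, J_of_nonneg hp ha, sub_neg_eq_add, abs_of_nonneg]
    · exact this
    · have := Real.rpow_nonneg ha (p - 1)
      have := Real.rpow_nonneg (by linarith : 0 ≤ -b) (p - 1)
      linarith

/-- For equal signs this is subadditivity of r^(p-1), as 0 < p - 1 ≤ 1; opposite signs cost the
factor 2. -/
theorem abs_J_sub_J_le_of_le_two {p : ℝ} (hp : 1 < p) (hp2 : p ≤ 2) (a b : ℝ) :
    |J p a - J p b| ≤ 2 * |a - b| ^ (p - 1) := by
  refine abs_J_sub_J_le_of_nonneg hp (F := fun a b => 2 * |a - b| ^ (p - 1)) ?_ ?_ ?_ ?_ a b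
  · intro a b
    simp only [abs_sub_comm]
  · intro a b
    simp only [← neg_sub', abs_neg]
  · intro a b hb hab
    have h := Real.rpow_add_le_add_rpow (p := p - 1) (sub_nonneg.2 hab) hb (by linarith)
      (by linarith)
    rw [sub_add_cancel] at h
    have h' : 0 ≤ (a - b) ^ (p - 1) := Real.rpow_nonneg (sub_nonneg.2 hab) _
    simp only [abs_of_nonneg (sub_nonneg.2 hab)]
    linarith
  · intro a b ha hb
    simp only [sub_neg_eq_add, abs_of_nonneg (add_nonneg ha hb)]
    have h₁ := Real.rpow_le_rpow ha (le_add_of_nonneg_right hb) (by linarith : 0 ≤ p - 1)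
    have h₂ := Real.rpow_le_rpow hb (le_add_of_nonneg_left ha) (by linarith : 0 ≤ p - 1)
    linarith

/-- Bernoulli's inequality settles equal signs; superadditivity of r^(p-1) settles opposite signs.
-/
theorem abs_J_sub_J_le_of_two_le {p : ℝ} (hp2 : 2 ≤ p) (a b : ℝ) :
    |J p a - J p b| ≤ (p - 1) * (|a| + |b|) ^ (p - 2) * |a - b| := by
  have hp : 1 < p := by linarith
  refine abs_J_sub_J_le_of_nonneg hp
    (F := fun a b => (p - 1) * (|a| + |b|) ^ (p - 2) * |a - b|) ?_ ?_ ?_ ?_ a b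
  · intro a b
    simp only [abs_sub_comm, add_comm]
  · intro a b
    simp only [← neg_sub', abs_neg]
  · intro a b hb hab
    simp only [abs_of_nonneg (sub_nonneg.2 hab), abs_of_nonneg hb, abs_of_nonneg (hb.trans hab)]
    rcases (hb.trans hab).eq_or_lt with ha | ha
    · have hb' : b = 0 := by linarith
      simp [← ha, hb']
    have hB := one_add_mul_self_le_rpow_one_add (s := b / a - 1) (p := p - 1)
      (by have := div_nonneg hb ha.le; linarith) (by linarith)
    rw [add_sub_cancel, Real.div_rpow hb ha.le, le_div_iff₀ (Real.rpow_pos_of_pos ha _)] at hB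
    have e : a ^ (p - 1) = a ^ (p - 2) * a := by
      rw [← Real.rpow_add_one ha.ne']; ring_nf
    have h1 : a ^ (p - 1) - b ^ (p - 1) ≤ (p - 1) * (a ^ (p - 2) * (a - b)) := by
      have : (1 + (p - 1) * (b / a - 1)) * a ^ (p - 1)
          = a ^ (p - 1) - (p - 1) * (a ^ (p - 2) * (a - b)) := by
        rw [e]; field_simp; ring
      linarith
    refine h1.trans ?_
    rw [mul_assoc]
    have h2 : a ^ (p - 2) ≤ (a + b) ^ (p - 2) :=
      Real.rpow_le_rpow ha.le (by linarith) (by linarith)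
    have h3 : 0 ≤ a - b := sub_nonneg.2 hab
    have h4 : 0 ≤ p - 1 := by linarith
    gcongr
  · intro a b ha hb
    simp only [sub_neg_eq_add, abs_neg, abs_of_nonneg ha, abs_of_nonneg hb,
      abs_of_nonneg (add_nonneg ha hb)]
    rcases (add_nonneg ha hb).eq_or_lt with h | h
    · have ha' : a = 0 := by linarith
      have hb' : b = 0 := by linarith
      simp [ha', hb', Real.zero_rpow (by linarith : p - 1 ≠ 0)]
    have h1 := Real.add_rpow_le_rpow_add ha hb (by linarith : 1 ≤ p - 1)
    have e : (a + b) ^ (p - 1) = (a + b) ^ (p - 2) * (a + b) := by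
      rw [← Real.rpow_add_one h.ne']; ring_nf
    have h2 : 0 ≤ (a + b) ^ (p - 2) * (a + b) := by positivity
    rw [mul_assoc]
    nlinarith

/-- Replacing `J (a - b)` by `-J b` costs a positive power of `a`. -/
theorem exists_abs_J_sub_add_J_le {p : ℝ} (hp : 1 < p) :
    ∃ C θ : ℝ, 0 ≤ C ∧ 0 < θ ∧ ∀ a b : ℝ, |a| ≤ 1 →
      |J p (a - b) + J p b| ≤ C * |a| ^ θ * (1 + |b| ^ (p - 1)) := by
  rcases le_total p 2 with hp2 | hp2
  · refine ⟨2, p - 1, by norm_num, by linarith, fun a b _ => ?_⟩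
    have h := abs_J_sub_J_le_of_le_two hp hp2 (a - b) (-b)
    rw [J_neg, sub_neg_eq_add, sub_neg_eq_add, sub_add_cancel] at h
    refine h.trans (le_mul_of_one_le_right (by positivity) ?_)
    have : 0 ≤ |b| ^ (p - 1) := by positivity
    linarith
  -- The 3 comes from |a - b| + |b| ≤ 1 + 2|b|. The exponent p - 2 may be raised to p - 1 because 3
  -- max(1, |b|) ≥ 1.
  · refine ⟨(p - 1) * 3 ^ (p - 1), 1, mul_nonneg (by linarith) (by positivity), one_pos,
      fun a b ha => ?_⟩
    have h := abs_J_sub_J_le_of_two_le hp2 (a - b) (-b)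
    rw [J_neg, sub_neg_eq_add, sub_neg_eq_add, sub_add_cancel, abs_neg] at h
    refine h.trans ?_
    have hb : 0 ≤ |b| := abs_nonneg b
    have hs : |a - b| + |b| ≤ 3 * max 1 |b| := by
      have := abs_sub a b
      have := le_max_left 1 |b|
      have := le_max_right 1 |b|
      linarith
    have hm : max 1 |b| ^ (p - 1) ≤ 1 + |b| ^ (p - 1) := by
      have : 0 ≤ |b| ^ (p - 1) := by positivity
      rcases max_cases 1 |b| with ⟨e, _⟩ | ⟨e, _⟩ <;> rw [e]
      · simpa using this
      · linarith
    have h3 : (|a - b| + |b|) ^ (p - 2) ≤ 3 ^ (p - 1) * (1 + |b| ^ (p - 1)) := by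
      calc (|a - b| + |b|) ^ (p - 2) ≤ (3 * max 1 |b|) ^ (p - 2) :=
            Real.rpow_le_rpow (by positivity) hs (by linarith)
        _ ≤ (3 * max 1 |b|) ^ (p - 1) :=
            Real.rpow_le_rpow_of_exponent_le (by linarith [le_max_left 1 |b|]) (by linarith)
        _ = 3 ^ (p - 1) * max 1 |b| ^ (p - 1) := Real.mul_rpow (by norm_num) (by positivity)
        _ ≤ _ := by gcongr
    rw [Real.rpow_one]
    have h4 : 0 ≤ p - 1 := by linarith
    calc (p - 1) * (|a - b| + |b|) ^ (p - 2) * |a|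
        ≤ (p - 1) * (3 ^ (p - 1) * (1 + |b| ^ (p - 1))) * |a| := by gcongr
      _ = _ := by ring

/-! ### Carleman's inequality -/

/-- The geometric means of a nonnegative sequence, compared with weighted arithmetic means. -/
theorem geom_mean_range_le {a : ℕ → ℝ} (ha : ∀ k, 0 ≤ a k) (k : ℕ) :
    (∏ j ∈ Finset.range (k + 1), a j) ^ (1 / ((k : ℝ) + 1))
      ≤ Real.exp 1 * ((∑ j ∈ Finset.range (k + 1), ((j : ℝ) + 1) * a j) / ((k : ℝ) + 1) ^ 2) := by
  have hk : (0 : ℝ) < (k : ℝ) + 1 := by positivity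
  -- AM-GM for (j + 1) a_j: the weights produce (k + 1)!, whose (k + 1)-th root is at least (k +
  -- 1)/e.
  have h1 := Real.geom_mean_le_arith_mean_weighted (Finset.range (k + 1))
    (fun _ => 1 / ((k : ℝ) + 1)) (fun j => ((j : ℝ) + 1) * a j) (fun _ _ => by positivity)
    (by simp; field_simp) (fun j _ => mul_nonneg (by positivity) (ha j))
  rw [← Finset.mul_sum, Real.finsetProd_rpow _ _
    (fun j _ => mul_nonneg (by positivity) (ha j)), Finset.prod_mul_distrib] at h1
  have hfac : ∏ j ∈ Finset.range (k + 1), ((j : ℝ) + 1) = ((k + 1).factorial : ℝ) := by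
    rw [← Finset.prod_range_add_one_eq_factorial]; push_cast; rfl
  rw [hfac, Real.mul_rpow (by positivity) (Finset.prod_nonneg fun j _ => ha j)] at h1
  have h2 : ((k : ℝ) + 1) / Real.exp 1 ≤ ((k + 1).factorial : ℝ) ^ (1 / ((k : ℝ) + 1)) := by
    have h := Real.pow_div_factorial_le_exp ((k : ℝ) + 1) hk.le (k + 1)
    rw [div_le_iff₀ (by positivity), mul_comm, ← div_le_iff₀ (Real.exp_pos _)] at h
    calc ((k : ℝ) + 1) / Real.exp 1
        = ((((k : ℝ) + 1) ^ (k + 1)) / Real.exp ((k : ℝ) + 1)) ^ (1 / ((k : ℝ) + 1)) := by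
          rw [Real.div_rpow (by positivity) (Real.exp_pos _).le, ← Real.rpow_natCast,
            ← Real.rpow_mul hk.le, ← Real.exp_mul]
          push_cast
          rw [mul_one_div_cancel hk.ne', Real.rpow_one]
      _ ≤ _ := Real.rpow_le_rpow (by positivity) h (by positivity)
  set G := (∏ j ∈ Finset.range (k + 1), a j) ^ (1 / ((k : ℝ) + 1))
  have hG : 0 ≤ G := Real.rpow_nonneg (Finset.prod_nonneg fun j _ => ha j) _
  have h3 : ((k : ℝ) + 1) / Real.exp 1 * G
      ≤ 1 / ((k : ℝ) + 1) * ∑ j ∈ Finset.range (k + 1), ((j : ℝ) + 1) * a j :=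
    (mul_le_mul_of_nonneg_right h2 hG).trans h1
  have he := Real.exp_pos 1
  calc G = Real.exp 1 / ((k : ℝ) + 1) * (((k : ℝ) + 1) / Real.exp 1 * G) := by field_simp
    _ ≤ Real.exp 1 / ((k : ℝ) + 1) *
      (1 / ((k : ℝ) + 1) * ∑ j ∈ Finset.range (k + 1), ((j : ℝ) + 1) * a j) := by gcongr
    _ = _ := by field_simp

/-- **Carleman's inequality**, qualitative form. -/
theorem summable_geom_mean {a : ℕ → ℝ} (ha : ∀ k, 0 ≤ a k) (hs : Summable a) :
    Summable fun k : ℕ => (∏ j ∈ Finset.range (k + 1), a j) ^ (1 / ((k : ℝ) + 1)) := by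
  refine Summable.of_nonneg_of_le
    (fun k => Real.rpow_nonneg (Finset.prod_nonneg fun j _ => ha j) _)
    (geom_mean_range_le ha) (Summable.mul_left _ ?_)
  have hT : ∀ K, 0 ≤ ∑ j ∈ Finset.range K, ((j : ℝ) + 1) * a j := fun K =>
    Finset.sum_nonneg fun j _ => mul_nonneg (by positivity) (ha j)
  -- The extra term accounts for the tail ∑_{k ≥ K} 1/(k+1)² ≤ 2/(K+1) of the double sum, so that
  -- induction on K replaces an interchange of summations.
  have key : ∀ K : ℕ, ∑ k ∈ Finset.range K,
      (∑ j ∈ Finset.range (k + 1), ((j : ℝ) + 1) * a j) / ((k : ℝ) + 1) ^ 2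
        + 2 / ((K : ℝ) + 1) * ∑ j ∈ Finset.range K, ((j : ℝ) + 1) * a j
      ≤ 2 * ∑ j ∈ Finset.range K, a j := by
    intro K
    induction K with
    | zero => simp
    | succ K ih =>
      rw [Finset.sum_range_succ, Finset.sum_range_succ (f := a)]
      have hT' := hT (K + 1)
      have hsucc := Finset.sum_range_succ (fun j : ℕ => ((j : ℝ) + 1) * a j) K
      set T' := ∑ j ∈ Finset.range (K + 1), ((j : ℝ) + 1) * a j
      set T := ∑ j ∈ Finset.range K, ((j : ℝ) + 1) * a j
      have hK : (0 : ℝ) < (K : ℝ) + 1 := by positivity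
      have e : 2 / ((K : ℝ) + 1) * T' = 2 / ((K : ℝ) + 1) * T + 2 * a K := by
        rw [hsucc]; field_simp
      have h1 : T' / ((K : ℝ) + 1) ^ 2 + 2 / (((K + 1 : ℕ) : ℝ) + 1) * T'
          ≤ 2 / ((K : ℝ) + 1) * T' := by
        have : 1 / ((K : ℝ) + 1) ^ 2 + 2 / (((K + 1 : ℕ) : ℝ) + 1) ≤ 2 / ((K : ℝ) + 1) := by
          push_cast
          rw [div_add_div _ _ (by positivity) (by positivity), div_le_div_iff₀ (by positivity)
            (by positivity)]
          have : (0 : ℝ) ≤ K := by positivity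
          nlinarith [mul_nonneg this this, mul_nonneg this (mul_nonneg this this)]
        calc _ = (1 / ((K : ℝ) + 1) ^ 2 + 2 / (((K + 1 : ℕ) : ℝ) + 1)) * T' := by ring
          _ ≤ _ := by gcongr
      linarith
  refine summable_of_sum_range_le (c := 2 * ∑' j, a j)
    (fun k => div_nonneg (hT _) (by positivity)) fun K => ?_
  have h1 := key K
  have h2 : 0 ≤ 2 / ((K : ℝ) + 1) * ∑ j ∈ Finset.range K, ((j : ℝ) + 1) * a j :=
    mul_nonneg (by positivity) (hT K)
  have h3 : ∑ j ∈ Finset.range K, a j ≤ ∑' j, a j := hs.sum_le_tsum _ fun j _ => ha j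
  linarith

/-- The ratios telescope to M 0 / M (k + 1), so their geometric means are the roots up to the factor
M 0 ^ (1/(k+1)), which is at least min(1, M 0). -/
theorem not_summable_ratio_of_not_summable_root {M : ℕ → ℝ} (hM : ∀ k, 0 < M k)
    (h : ¬ Summable fun k : ℕ => (M (k + 1) ^ (1 / ((k : ℝ) + 1)))⁻¹) :
    ¬ Summable fun k => M k / M (k + 1) := by
  intro hs
  refine h ?_
  have h1 := summable_geom_mean (fun k => (div_pos (hM k) (hM (k + 1))).le) hs
  refine Summable.of_nonneg_of_le (fun k => inv_nonneg.2 (Real.rpow_nonneg (hM _).le _))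
    (fun k => ?_) (h1.mul_left (max 1 (M 0)⁻¹))
  have hprod : ∀ n, ∏ j ∈ Finset.range n, M j / M (j + 1) = M 0 / M n := fun n => by
    induction n with
    | zero => simp [(hM 0).ne']
    | succ n ih =>
      have := hM n
      rw [Finset.prod_range_succ, ih]
      field_simp
  rw [hprod, Real.div_rpow (hM _).le (hM _).le, div_eq_mul_inv (M 0 ^ _), ← mul_assoc]
  refine le_mul_of_one_le_left (inv_nonneg.2 (Real.rpow_nonneg (hM _).le _)) ?_
  have hk : (0 : ℝ) < 1 / ((k : ℝ) + 1) := by positivity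
  have hk1 : 1 / ((k : ℝ) + 1) ≤ 1 := by
    rw [div_le_one (by positivity)]
    linarith [Nat.cast_nonneg (α := ℝ) k]
  rcases le_total 1 (M 0) with h0 | h0
  · exact one_le_mul_of_one_le_of_one_le (le_max_left _ _) (Real.one_le_rpow h0 hk.le)
  · calc (1 : ℝ) = (M 0)⁻¹ * M 0 := (inv_mul_cancel₀ (hM 0).ne').symm
      _ ≤ max 1 (M 0)⁻¹ * M 0 ^ (1 / ((k : ℝ) + 1)) := by
          have := Real.rpow_le_rpow_of_exponent_ge (hM 0) h0 hk1
          rw [Real.rpow_one] at this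
          have := hM 0
          gcongr
          exact le_max_right _ _

/-! ### The Denjoy–Carleman theorem -/

theorem ratio_monotone {M : ℕ → ℝ} (hM : ∀ k, 0 < M k)
    (hlog : ∀ k, M (k + 1) ^ 2 ≤ M k * M (k + 2)) : Monotone fun k => M (k + 1) / M k := by
  refine monotone_nat_of_le_succ fun k => ?_
  rw [div_le_div_iff₀ (hM _) (hM _)]
  nlinarith [hlog k]

/-- One step of Bang's argument: a jet that is small to order `N + 1` stays small to order `N` on
an interval of length `M N / (e * M (N + 1))`. -/
theorem bang_step {M : ℕ → ℝ} (hM : ∀ k, 0 < M k)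
    (hlog : ∀ k, M (k + 1) ^ 2 ≤ M k * M (k + 2)) {f : ℕ → ℝ → ℂ}
    (hf : ∀ n t, HasDerivAt (f n) (f (n + 1) t) t) (hb : ∀ n t, ‖f n t‖ ≤ M n) {N : ℕ} {x h : ℝ}
    (hx : ∀ n, ‖f n x‖ ≤ Real.exp ((n : ℝ) - (N + 1)) * M n) (h0 : 0 ≤ h)
    (hh : h ≤ M N / (Real.exp 1 * M (N + 1))) (n : ℕ) :
    ‖f n (x + h)‖ ≤ Real.exp ((n : ℝ) - N) * M n := by
  -- By log-convexity R bounds e * M (n + 1) / M n for all n ≤ N, while R * h ≤ 1.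
  set R := Real.exp 1 * (M (N + 1) / M N)
  have hR : 0 < R := mul_pos (Real.exp_pos _) (div_pos (hM _) (hM _))
  -- Descending induction on n from N + 1, where `hb` suffices; each further n integrates the bound
  -- of the next derivative.
  have key : ∀ m n, n + m = N + 1 → ∀ t ∈ Set.Icc x (x + h),
      ‖f n t‖ ≤ Real.exp ((n : ℝ) - (N + 1)) * M n * Real.exp (R * (t - x)) := by
    intro m
    induction m with
    | zero =>
      intro n hn t ht
      have hn' : n = N + 1 := by omega
      subst hn'
      refine (hb _ t).trans ?_
      push_cast
      rw [sub_self, Real.exp_zero, one_mul]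
      exact le_mul_of_one_le_right (hM _).le
        (Real.one_le_exp (mul_nonneg hR.le (sub_nonneg.2 ht.1)))
    | succ m ih =>
      intro n hn
      refine image_norm_le_of_norm_deriv_right_le_deriv_boundary (f' := f (n + 1))
        (B' := fun t => Real.exp ((n : ℝ) - (N + 1)) * M n * (Real.exp (R * (t - x)) * R))
        (fun t _ => (hf n t).continuousAt.continuousWithinAt)
        (fun t _ => (hf n t).hasDerivWithinAt) ?_ (fun t => ?_) fun t ht => ?_
      · simpa using hx n
      · have h1 : HasDerivAt (fun t => R * (t - x)) R t := by
          simpa using ((hasDerivAt_id t).sub_const x).const_mul R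
        exact h1.exp.const_mul _
      · refine (ih (n + 1) (by omega) t ⟨ht.1, ht.2.le⟩).trans ?_
        have hmono := ratio_monotone hM hlog (by omega : n ≤ N)
        simp only at hmono
        have h2 : M (n + 1) ≤ M (N + 1) / M N * M n := (div_le_iff₀ (hM n)).1 hmono
        have e : Real.exp (((n + 1 : ℕ) : ℝ) - (N + 1))
            = Real.exp ((n : ℝ) - (N + 1)) * Real.exp 1 := by
          rw [← Real.exp_add]; push_cast; ring_nf
        rw [e]
        calc Real.exp ((n : ℝ) - (N + 1)) * Real.exp 1 * M (n + 1) * Real.exp (R * (t - x))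
            ≤ Real.exp ((n : ℝ) - (N + 1)) * Real.exp 1 * (M (N + 1) / M N * M n)
              * Real.exp (R * (t - x)) := by gcongr
          _ = _ := by simp only [R]; ring
  rcases Nat.lt_or_ge n (N + 1) with hn | hn
  · refine (key (N + 1 - n) n (by omega) (x + h) ⟨by linarith, le_rfl⟩).trans ?_
    have hRh : R * (x + h - x) ≤ 1 := by
      have hM1 := hM N
      have hM2 := hM (N + 1)
      have he := Real.exp_pos 1
      calc R * (x + h - x) = R * h := by ring
        _ ≤ R * (M N / (Real.exp 1 * M (N + 1))) := by gcongr
        _ = 1 := by simp only [R]; field_simp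
    have e : Real.exp ((n : ℝ) - N) = Real.exp ((n : ℝ) - (N + 1)) * Real.exp 1 := by
      rw [← Real.exp_add]; ring_nf
    rw [e]
    have := hM n
    calc _ ≤ Real.exp ((n : ℝ) - (N + 1)) * M n * Real.exp 1 := by gcongr
      _ = _ := by ring
  · refine (hb _ _).trans (le_mul_of_one_le_left (hM n).le (Real.one_le_exp ?_))
    have : ((N + 1 : ℕ) : ℝ) ≤ n := by exact_mod_cast hn
    push_cast at this
    linarith

/-- Starting from the flat point 0, t is reached by steps of lengths at most δ (N + m - 1), ..., δ
N, each losing one order of smallness. As ∑ δ diverges, the final order N is arbitrary, so |f 0 t| ≤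
e^(-N) M 0 for all N. -/
theorem eq_zero_of_quasianalytic_of_nonneg {M : ℕ → ℝ} (hM : ∀ k, 0 < M k)
    (hlog : ∀ k, M (k + 1) ^ 2 ≤ M k * M (k + 2)) (hdiv : ¬ Summable fun k => M k / M (k + 1))
    {f : ℕ → ℝ → ℂ} (hf : ∀ n t, HasDerivAt (f n) (f (n + 1) t) t) (hb : ∀ n t, ‖f n t‖ ≤ M n)
    (h0 : ∀ n, f n 0 = 0) {t : ℝ} (ht : 0 ≤ t) : f 0 t = 0 := by
  set δ : ℕ → ℝ := fun k => M k / (Real.exp 1 * M (k + 1))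
  have hδ : ∀ k, 0 < δ k := fun k => div_pos (hM k) (mul_pos (Real.exp_pos _) (hM _))
  have step : ∀ m N : ℕ, ∀ x : ℝ, 0 ≤ x → x ≤ ∑ k ∈ Finset.range m, δ (N + k) →
      ∀ n, ‖f n x‖ ≤ Real.exp ((n : ℝ) - N) * M n := by
    intro m
    induction m with
    | zero =>
      intro N x hx hx' n
      have : x = 0 := le_antisymm (by simpa using hx') hx
      rw [this, h0, norm_zero]
      exact mul_nonneg (Real.exp_pos _).le (hM n).le
    | succ m ih =>
      intro N x hx hx' n
      rw [Finset.sum_range_succ'] at hx'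
      -- Go back by δ N, but not beyond 0, to a point where order N + 1 is known.
      have hy := ih (N + 1) (max 0 (x - δ N)) (le_max_left _ _) (max_le
        (Finset.sum_nonneg fun k _ => (hδ _).le) (by
          rw [sub_le_iff_le_add]
          refine hx'.trans_eq ?_
          simp only [add_assoc, add_comm 1, add_zero]))
      have h1 : 0 ≤ x - max 0 (x - δ N) := by
        rw [sub_nonneg]; exact max_le hx (by linarith [hδ N])
      have h2 : x - max 0 (x - δ N) ≤ δ N := by
        have := le_max_right 0 (x - δ N); linarith
      have := bang_step hM hlog hf hb (N := N) (fun n => by simpa using hy n) h1 h2 n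
      rwa [add_sub_cancel] at this
  have hbd : ∀ N : ℕ, ‖f 0 t‖ ≤ Real.exp (-(N : ℝ)) * M 0 := by
    intro N
    have hns : ¬ Summable fun k => δ (N + k) := by
      intro hs
      refine hdiv ?_
      have h1 : Summable fun k => δ (k + N) := by simpa only [add_comm] using hs
      have h2 := ((summable_nat_add_iff N).1 h1).mul_left (Real.exp 1)
      refine h2.congr fun k => ?_
      have := hM (k + 1)
      have := Real.exp_pos 1
      simp only [δ]
      field_simp
    have htend := (not_summable_iff_tendsto_nat_atTop_of_nonneg fun k => (hδ (N + k)).le).1 hns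
    obtain ⟨m, hm⟩ := (htend.eventually_ge_atTop t).exists
    simpa using step m N t ht hm 0
  have hlim : Tendsto (fun N : ℕ => Real.exp (-(N : ℝ)) * M 0) atTop (𝓝 (0 * M 0)) :=
    (Real.tendsto_exp_neg_atTop_nhds_zero.comp tendsto_natCast_atTop_atTop).mul_const _
  rw [zero_mul] at hlim
  exact norm_le_zero_iff.1 (ge_of_tendsto' hlim hbd)

/-- **Denjoy–Carleman theorem** (Bang's proof): a function that is flat at `0`, and whose
derivatives are bounded by a log-convex sequence `M` with `∑ M k / M (k + 1) = ∞`, vanishes. -/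
theorem eq_zero_of_quasianalytic {M : ℕ → ℝ} (hM : ∀ k, 0 < M k)
    (hlog : ∀ k, M (k + 1) ^ 2 ≤ M k * M (k + 2)) (hdiv : ¬ Summable fun k => M k / M (k + 1))
    {f : ℕ → ℝ → ℂ} (hf : ∀ n t, HasDerivAt (f n) (f (n + 1) t) t) (hb : ∀ n t, ‖f n t‖ ≤ M n)
    (h0 : ∀ n, f n 0 = 0) (t : ℝ) : f 0 t = 0 := by
  rcases le_total 0 t with ht | ht
  · exact eq_zero_of_quasianalytic_of_nonneg hM hlog hdiv hf hb h0 ht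
  · have := eq_zero_of_quasianalytic_of_nonneg hM hlog hdiv
      (f := fun n t => (-1) ^ n * f n (-t)) (fun n t => ?_) (fun n t => by simpa using hb n (-t))
      (fun n => by simp [h0]) (neg_nonneg.2 ht)
    · simpa using this
    · have h1 := ((hf n (-t)).scomp t (hasDerivAt_neg t)).const_mul ((-1 : ℂ) ^ n)
      refine h1.congr_deriv ?_
      simp [pow_succ]

/-! ### Carleman's criterion for the moment problem -/

section Moments

variable {d : ℕ} {Y : Type*} [MeasurableSpace Y] {m : Measure Y}
  {z : Y → EuclideanSpace ℝ (Fin d)} {ω : Y → ℝ}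

theorem integrable_eval_mul (hz : Measurable z)
    (hω : ∀ n : ℕ, Integrable (fun y => ‖z y‖ ^ n * ω y) m) (q : MvPolynomial (Fin d) ℝ) :
    Integrable (fun y => MvPolynomial.eval (fun i => z y i) q * ω y) m := by
  -- The spare power of ‖z‖ absorbs the new factor `z y i` in the induction.
  suffices h : ∀ n : ℕ,
      Integrable (fun y => MvPolynomial.eval (fun i => z y i) q * (‖z y‖ ^ n * ω y)) m by
    simpa using h 0
  have hω0 : AEStronglyMeasurable ω m := by simpa using (hω 0).aestronglyMeasurable
  induction q using MvPolynomial.induction_on with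
  | C a => intro n; simpa using (hω n).const_mul a
  | add q r hq hr => 
    intro n
    simp only [map_add, add_mul]
    exact (hq n).add (hr n)
  | mul_X q i hq =>
    intro n
    refine (hq (n + 1)).mono ?_ (ae_of_all _ fun y => ?_)
    · have h1 : Measurable fun y => MvPolynomial.eval (fun i => z y i) (q * MvPolynomial.X i) :=
        (MvPolynomial.continuous_eval _).measurable.comp (by fun_prop)
      exact h1.aestronglyMeasurable.mul ((hz.norm.pow_const n).aestronglyMeasurable.mul hω0)
    · simp only [map_mul, MvPolynomial.eval_X, norm_mul, norm_pow, norm_norm, pow_succ]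
      have h1 := PiLp.norm_apply_le (z y) i
      calc _ = ‖MvPolynomial.eval (fun i => z y i) q‖ * (‖z y‖ ^ n * ‖z y i‖ * ‖ω y‖) := by ring
        _ ≤ _ := by gcongr

/-- Cauchy–Schwarz, from the discriminant of the nonnegative quadratic t ↦ ∫ (f t + g)² w. -/
theorem sq_integral_mul_le {f g : Y → ℝ} {w : Y → ℝ} (hw : ∀ y, 0 ≤ w y)
    (hf : Integrable (fun y => f y ^ 2 * w y) m) (hg : Integrable (fun y => g y ^ 2 * w y) m)
    (hfg : Integrable (fun y => f y * g y * w y) m) :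
    (∫ y, f y * g y * w y ∂m) ^ 2 ≤ (∫ y, f y ^ 2 * w y ∂m) * ∫ y, g y ^ 2 * w y ∂m := by
  have h : ∀ t : ℝ, 0 ≤ (∫ y, f y ^ 2 * w y ∂m) * (t * t)
      + (2 * ∫ y, f y * g y * w y ∂m) * t + ∫ y, g y ^ 2 * w y ∂m := by
    intro t
    have e : (∫ y, f y ^ 2 * w y ∂m) * (t * t)
      + (2 * ∫ y, f y * g y * w y ∂m) * t + ∫ y, g y ^ 2 * w y ∂m
      = ∫ y, (f y * t + g y) ^ 2 * w y ∂m := by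
      rw [← integral_mul_const, ← integral_const_mul, ← integral_mul_const,
        ← integral_add (hf.mul_const _) ((hfg.const_mul 2).mul_const t)]
      refine (integral_add ((hf.mul_const _).add ((hfg.const_mul 2).mul_const t)) hg).symm.trans ?_
      simp only [Pi.add_apply]
      congr with y
      ring
    rw [e]
    exact integral_nonneg fun y => mul_nonneg (sq_nonneg _) (hw y)
  have := discrim_le_zero h
  rw [discrim] at this
  nlinarith

theorem norm_cexp_ofReal_mul_I_mul (a : ℝ) (b : ℂ) :
    ‖Complex.exp ((a : ℂ) * Complex.I) * b‖ = ‖b‖ := by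
  rw [norm_mul, Complex.norm_exp_ofReal_mul_I, one_mul]

/-- Passage from frequencies `ξ` to frequencies `ξ + t e_i` by quasi-analyticity in `t`. -/
theorem integral_cexp_mul_eq_zero_of_carleman (hz : Measurable z)
    (hω : ∀ n : ℕ, Integrable (fun y => ‖z y‖ ^ n * ω y) m) (i : Fin d)
    (hpos : ∀ k : ℕ, 0 < ∫ y, z y i ^ (2 * k) * |ω y| ∂m)
    (hdiv : ¬ Summable fun k : ℕ =>
      ((∫ y, z y i ^ (2 * (k + 1)) * |ω y| ∂m) ^ (1 / (2 * ((k : ℝ) + 1))))⁻¹)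
    (ξ : EuclideanSpace ℝ (Fin d))
    (h0 : ∀ q : MvPolynomial (Fin d) ℝ, ∫ y, Complex.exp ((inner ℝ (z y) ξ : ℝ) * Complex.I)
      * ((MvPolynomial.eval (fun i => z y i) q * ω y : ℝ) : ℂ) ∂m = 0)
    (t : ℝ) (q : MvPolynomial (Fin d) ℝ) :
    ∫ y, Complex.exp ((inner ℝ (z y) (ξ + t • EuclideanSpace.single i 1) : ℝ) * Complex.I)
      * ((MvPolynomial.eval (fun i => z y i) q * ω y : ℝ) : ℂ) ∂m = 0 := by
  have hω0 : AEStronglyMeasurable ω m := by simpa using (hω 0).aestronglyMeasurable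
  have hωa : ∀ n : ℕ, Integrable (fun y => ‖z y‖ ^ n * |ω y|) m := fun n => by
    simpa [abs_mul] using (hω n).abs
  have hpoly := integrable_eval_mul hz hω
  have hpolya := integrable_eval_mul hz hωa
  have hzi : Measurable fun y => z y i := by fun_prop
  set m' : ℕ → ℝ := fun k => ∫ y, z y i ^ (2 * k) * |ω y| ∂m
  set Q := ∫ y, MvPolynomial.eval (fun i => z y i) q ^ 2 * |ω y| ∂m
  have hQ0 : 0 ≤ Q := integral_nonneg fun y => by positivity
  -- The `+ 1` keeps `M` positive when Q = 0.
  set K := Real.sqrt Q + 1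
  have hK : 0 < K := by positivity
  set M : ℕ → ℝ := fun k => K * Real.sqrt (m' k)
  have hM : ∀ k, 0 < M k := fun k => mul_pos hK (Real.sqrt_pos.2 (hpos k))
  have hXint : ∀ k : ℕ, Integrable (fun y => z y i ^ k * |ω y|) m := fun k => by
    simpa using hpolya (MvPolynomial.X i ^ k)
  have hlog : ∀ k, M (k + 1) ^ 2 ≤ M k * M (k + 2) := by
    intro k
    have h1 := sq_integral_mul_le (m := m) (f := fun y => z y i ^ k) (g := fun y => z y i ^ (k + 2))
      (w := fun y => |ω y|) (fun y => abs_nonneg _)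
      (by simpa only [← pow_mul] using hXint (k * 2))
      (by simpa only [← pow_mul] using hXint ((k + 2) * 2))
      (by simpa only [← pow_add] using hXint (k + (k + 2)))
    have h2 : m' (k + 1) ^ 2 ≤ m' k * m' (k + 2) := by
      simp only [← pow_mul, ← pow_add] at h1
      convert! h1 using 5 <;> ring_nf
    have h3 : m' (k + 1) ≤ Real.sqrt (m' k) * Real.sqrt (m' (k + 2)) := by
      rw [← Real.sqrt_mul (hpos k).le]
      exact Real.le_sqrt_of_sq_le h2
    calc M (k + 1) ^ 2 = K ^ 2 * m' (k + 1) := by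
          simp only [M, mul_pow]; rw [Real.sq_sqrt (hpos (k + 1)).le]
      _ ≤ K ^ 2 * (Real.sqrt (m' k) * Real.sqrt (m' (k + 2))) := by gcongr
      _ = _ := by simp only [M]; ring
  have hdiv' : ¬ Summable fun k => M k / M (k + 1) := by
    have h1 := not_summable_ratio_of_not_summable_root (M := fun k => Real.sqrt (m' k))
      (fun k => Real.sqrt_pos.2 (hpos k)) (by
        refine fun hs => hdiv (hs.congr fun k => ?_)
        have : 0 < (k : ℝ) + 1 := by positivity
        rw [Real.sqrt_eq_rpow, ← Real.rpow_mul (hpos (k + 1)).le]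
        congr 2
        field_simp)
    refine fun hs => h1 (hs.congr fun k => ?_)
    exact mul_div_mul_left _ _ hK.ne'
  -- The n-th t-derivative of the integrand. Cauchy–Schwarz bounds its integral by the square root
  -- of (∫ z_i^(2n) |ω|) Q, hence by M n.
  set F : ℕ → ℝ → Y → ℂ := fun n t y =>
    Complex.exp (((inner ℝ (z y) ξ + t * z y i : ℝ) : ℂ) * Complex.I) *
      ((Complex.I * (z y i : ℂ)) ^ n * ((MvPolynomial.eval (fun i => z y i) q * ω y : ℝ) : ℂ))
  have hFnorm : ∀ n t y, ‖F n t y‖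
      = |z y i| ^ n * |MvPolynomial.eval (fun i => z y i) q * ω y| := by
    intro n t y
    rw [norm_cexp_ofReal_mul_I_mul]
    simp only [norm_mul, norm_pow, Complex.norm_I, one_mul,
      Complex.norm_real, Real.norm_eq_abs, abs_mul]
  have hevalm : Measurable fun y => MvPolynomial.eval (fun i => z y i) q :=
    (MvPolynomial.continuous_eval _).measurable.comp (by fun_prop)
  have hFmeas : ∀ n t, AEStronglyMeasurable (F n t) m := by
    intro n t
    refine AEStronglyMeasurable.mul (Measurable.aestronglyMeasurable (by fun_prop))
      (AEStronglyMeasurable.mul (Measurable.aestronglyMeasurable (by fun_prop)) ?_)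
    exact Complex.continuous_ofReal.comp_aestronglyMeasurable
      (hevalm.aestronglyMeasurable.mul hω0)
  have hbint : ∀ n, Integrable
      (fun y => |z y i| ^ n * |MvPolynomial.eval (fun i => z y i) q * ω y|) m := by
    intro n
    have h := (hpoly (MvPolynomial.X i ^ n * q)).abs
    simpa only [map_mul, map_pow, MvPolynomial.eval_X, abs_mul, abs_pow, mul_assoc] using h
  have hFint : ∀ n t, Integrable (F n t) m := fun n t =>
    (hbint n).mono' (hFmeas n t) (ae_of_all _ fun y => (hFnorm n t y).le)
  set f : ℕ → ℝ → ℂ := fun n t => ∫ y, F n t y ∂m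
  have hf : ∀ n t, HasDerivAt (f n) (f (n + 1) t) t := by
    intro n t
    refine (hasDerivAt_integral_of_dominated_loc_of_deriv_le (s := Set.univ) (F' := F (n + 1))
      univ_mem (Eventually.of_forall fun t => hFmeas n t)
      (hFint n t) (hFmeas (n + 1) t) (ae_of_all _ fun y t _ => (hFnorm (n + 1) t y).le)
      (hbint (n + 1)) (ae_of_all _ fun y t _ => ?_)).2
    have h1 : HasDerivAt (fun t : ℝ => ((inner ℝ (z y) ξ + t * z y i : ℝ) : ℂ) * Complex.I)
        ((z y i : ℂ) * Complex.I) t := by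
      have : HasDerivAt (fun t : ℝ => inner ℝ (z y) ξ + t * z y i) (z y i) t := by
        simpa using ((hasDerivAt_id t).mul_const (z y i)).const_add (inner ℝ (z y) ξ)
      exact this.ofReal_comp.mul_const _
    refine (h1.cexp.mul_const _).congr_deriv ?_
    simp only [F]
    ring
  have hb : ∀ n t, ‖f n t‖ ≤ M n := by
    intro n t
    refine (norm_integral_le_integral_norm _).trans ?_
    simp only [hFnorm]
    have h1 := sq_integral_mul_le (m := m) (f := fun y => |z y i| ^ n)
      (g := fun y => |MvPolynomial.eval (fun i => z y i) q|)
      (w := fun y => |ω y|) (fun y => abs_nonneg _)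
      (by simpa only [← pow_mul, mul_comm n 2, (even_two_mul n).pow_abs] using hXint (2 * n))
      (by simpa only [map_mul, sq, abs_mul_abs_self] using hpolya (q * q))
      (by simpa [abs_mul, mul_assoc] using hbint n)
    have e : (fun y => |z y i| ^ n * |MvPolynomial.eval (fun i => z y i) q * ω y|)
        = fun y => |z y i| ^ n * |MvPolynomial.eval (fun i => z y i) q| * |ω y| := by
      ext y; rw [abs_mul, mul_assoc]
    rw [e]
    have h2 : (∫ y, |z y i| ^ n * |MvPolynomial.eval (fun i => z y i) q| * |ω y| ∂m) ^ 2
        ≤ m' n * Q := by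
      refine h1.trans_eq ?_
      simp only [m', Q, ← pow_mul, mul_comm n 2, sq_abs, (even_two_mul n).pow_abs]
    refine (Real.le_sqrt_of_sq_le h2).trans ?_
    rw [Real.sqrt_mul (hpos n).le, mul_comm]
    simp only [M, K]
    gcongr
    linarith
  -- Differentiation at t = 0 replaces q by X_i^n q, which is why `h0` is required for all q.
  have hf0 : ∀ n, f n 0 = 0 := by
    intro n
    have h1 := congrArg (fun w : ℂ => Complex.I ^ n * w) (h0 (MvPolynomial.X i ^ n * q))
    simp only [mul_zero] at h1
    rw [← h1, ← integral_const_mul]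
    simp only [f, F]
    congr with y
    simp only [zero_mul, add_zero, map_mul, map_pow, MvPolynomial.eval_X, mul_pow]
    push_cast
    ring
  have := eq_zero_of_quasianalytic hM hlog hdiv' hf hb hf0 t
  rw [← this]
  simp only [f, F]
  congr with y
  rw [inner_add_right, inner_smul_right, EuclideanSpace.inner_single_right]
  simp

/-- The coordinates of ξ are switched on one at a time, keeping all polynomials q in the claim for
the sake of the next coordinate. -/
theorem integral_cexp_mul_eq_zero (hz : Measurable z)
    (hω : ∀ n : ℕ, Integrable (fun y => ‖z y‖ ^ n * ω y) m)
    (hpos : ∀ (i : Fin d) (k : ℕ), 0 < ∫ y, z y i ^ (2 * k) * |ω y| ∂m)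
    (hdiv : ∀ i : Fin d, ¬ Summable fun k : ℕ =>
      ((∫ y, z y i ^ (2 * (k + 1)) * |ω y| ∂m) ^ (1 / (2 * ((k : ℝ) + 1))))⁻¹)
    (h0 : ∀ q : MvPolynomial (Fin d) ℝ, ∫ y, MvPolynomial.eval (fun i => z y i) q * ω y ∂m = 0)
    (ξ : EuclideanSpace ℝ (Fin d)) :
    ∫ y, Complex.exp ((inner ℝ (z y) ξ : ℝ) * Complex.I) * (ω y : ℂ) ∂m = 0 := by
  have key : ∀ (S : Finset (Fin d)) (q : MvPolynomial (Fin d) ℝ),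
      ∫ y, Complex.exp ((inner ℝ (z y) (∑ i ∈ S, ξ i • EuclideanSpace.single i (1 : ℝ)) : ℝ)
        * Complex.I) * ((MvPolynomial.eval (fun i => z y i) q * ω y : ℝ) : ℂ) ∂m = 0 := by
    intro S
    induction S using Finset.induction_on with
    | empty =>
      intro q
      simp only [Finset.sum_empty, inner_zero_right, Complex.ofReal_zero, zero_mul,
        Complex.exp_zero, one_mul]
      rw [integral_complex_ofReal, h0, Complex.ofReal_zero]
    | insert i S hi ih =>
      intro q
      rw [Finset.sum_insert hi, add_comm]
      exact integral_cexp_mul_eq_zero_of_carleman hz hω i (hpos i) (hdiv i) _ ih (ξ i) q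
  have hξ : ∑ i, ξ i • EuclideanSpace.single i (1 : ℝ) = ξ := by
    ext j
    simp [Finset.sum_apply, Pi.single_apply]
  simpa [hξ] using key Finset.univ 1

/-- **Carleman's criterion** in several variables: a density whose moments vanish is zero when the
moments of its modulus in each coordinate satisfy Carleman's condition. -/
theorem ae_eq_zero_of_carleman [SigmaFinite m] (hz : Measurable z)
    {g : EuclideanSpace ℝ (Fin d) → Y} (hg : Measurable g) (hgz : ∀ y, g (z y) = y)
    (hω : ∀ n : ℕ, Integrable (fun y => ‖z y‖ ^ n * ω y) m)
    (hpos : ∀ (i : Fin d) (k : ℕ), 0 < ∫ y, z y i ^ (2 * k) * |ω y| ∂m)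
    (hdiv : ∀ i : Fin d, ¬ Summable fun k : ℕ =>
      ((∫ y, z y i ^ (2 * (k + 1)) * |ω y| ∂m) ^ (1 / (2 * ((k : ℝ) + 1))))⁻¹)
    (h0 : ∀ q : MvPolynomial (Fin d) ℝ, ∫ y, MvPolynomial.eval (fun i => z y i) q * ω y ∂m = 0) :
    ω =ᵐ[m] 0 := by
  have hint : Integrable ω m := by simpa using hω 0
  have hm : AEMeasurable ω m := hint.aestronglyMeasurable.aemeasurable
  have hm' : AEMeasurable (fun y => -ω y) m := hm.neg
  -- The positive and negative parts of ω have images under z with equal characteristic functions;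
  -- the left inverse g carries the equality back to Y.
  set μ := m.withDensity fun y => ENNReal.ofReal (ω y)
  set ν := m.withDensity fun y => ENNReal.ofReal (-ω y)
  have : IsFiniteMeasure μ := isFiniteMeasure_withDensity_ofReal hint.2
  have : IsFiniteMeasure ν := isFiniteMeasure_withDensity_ofReal hint.neg.2
  have hmap : μ.map z = ν.map z := by
    refine Measure.ext_of_charFun (funext fun ξ => ?_)
    have hE : Measurable fun y => Complex.exp ((inner ℝ (z y) ξ : ℝ) * Complex.I) := by
      fun_prop
    have hcont : Continuous fun x : EuclideanSpace ℝ (Fin d) =>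
        Complex.exp ((inner ℝ x ξ : ℝ) * Complex.I) := by fun_prop
    rw [charFun_apply, charFun_apply, integral_map hz.aemeasurable hcont.aestronglyMeasurable,
      integral_map hz.aemeasurable hcont.aestronglyMeasurable,
      integral_withDensity_eq_integral_toReal_smul₀ hm.ennreal_ofReal (by simp),
      integral_withDensity_eq_integral_toReal_smul₀ hm'.ennreal_ofReal (by simp),
      ← sub_eq_zero, ← integral_sub, ← integral_cexp_mul_eq_zero hz hω hpos hdiv h0 ξ]
    · congr with y
      rw [← sub_smul, ENNReal.toReal_ofReal', ENNReal.toReal_ofReal', Complex.real_smul, mul_comm]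
      congr 2
      rcases le_total 0 (ω y) with h | h
      · rw [max_eq_left h, max_eq_right (by linarith), sub_zero]
      · rw [max_eq_right h, max_eq_left (by linarith)]; ring
    · refine hint.norm.mono' ((hm.ennreal_ofReal.ennreal_toReal.aestronglyMeasurable).smul
        hE.aestronglyMeasurable) (ae_of_all _ fun y => ?_)
      rw [norm_smul, Complex.norm_exp_ofReal_mul_I, mul_one, ENNReal.toReal_ofReal']
      simpa using abs_max_le_max_abs_abs (a := ω y) (b := 0)
    · refine hint.norm.mono' ((hm'.ennreal_ofReal.ennreal_toReal.aestronglyMeasurable).smul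
        hE.aestronglyMeasurable) (ae_of_all _ fun y => ?_)
      rw [norm_smul, Complex.norm_exp_ofReal_mul_I, mul_one, ENNReal.toReal_ofReal']
      simpa using abs_max_le_max_abs_abs (a := -ω y) (b := 0)
  have hμν : μ = ν := by
    have h := congrArg (Measure.map g) hmap
    rw [Measure.map_map hg hz, Measure.map_map hg hz] at h
    have e : g ∘ z = id := funext hgz
    rwa [e, Measure.map_id, Measure.map_id] at h
  have h := (withDensity_eq_iff_of_sigmaFinite hm.ennreal_ofReal hm'.ennreal_ofReal).1 hμν
  filter_upwards [h] with y hy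
  rcases le_total 0 (ω y) with h' | h'
  · rw [ENNReal.ofReal_of_nonpos (neg_nonpos.2 h'), ENNReal.ofReal_eq_zero] at hy
    exact le_antisymm hy h'
  · rw [ENNReal.ofReal_of_nonpos h', eq_comm, ENNReal.ofReal_eq_zero] at hy
    exact le_antisymm h' (neg_nonpos.1 hy)

end Moments

/-! ### Taylor polynomials of (1 + t)^(-r) -/

section BinomialPolynomial

open Polynomial

/-- The Taylor polynomial of degree `< N` of `(1 + t)^(-r)` at `0`. -/
noncomputable def binomialPoly (r : ℝ) (N : ℕ) : ℝ[X] :=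
  ∑ j ∈ Finset.range N, C (Ring.choose (-r) j) * X ^ j

theorem binomialPoly_succ (r : ℝ) (N : ℕ) :
    binomialPoly r (N + 1) = binomialPoly r N + C (Ring.choose (-r) N) * X ^ N :=
  Finset.sum_range_succ _ _

theorem derivative_binomialPoly (r : ℝ) (N : ℕ) :
    derivative (binomialPoly r (N + 1)) = C (-r) * binomialPoly (r + 1) N := by
  induction N with
  | zero => simp [binomialPoly]
  | succ N ih =>
    have h := Ring.choose_smul_choose (-r) (Nat.le_add_left 1 N)
    rw [Nat.choose_one_right, Ring.choose_one_right, Nat.add_sub_cancel, nsmul_eq_mul,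
      Nat.cast_one, show -r - 1 = -(r + 1) by ring] at h
    rw [binomialPoly_succ r (N + 1), derivative_add, ih, binomialPoly_succ (r + 1) N,
      derivative_C_mul_X_pow, mul_add, ← mul_assoc, ← C_mul, ← h, Nat.add_sub_cancel, mul_comm
      (Ring.choose (-r) (N + 1))]

/-- Truncation of (1 + t)(1 + t)^(-r-1) = (1 + t)^(-r); by Pascal's rule the error is a single
monomial. -/
theorem one_add_X_mul_binomialPoly (r : ℝ) (N : ℕ) :
    (1 + X) * binomialPoly (r + 1) (N + 1)
      = binomialPoly r (N + 1) + C (Ring.choose (-(r + 1)) N) * X ^ (N + 1) := by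
  induction N with
  | zero => simp [binomialPoly]
  | succ N ih =>
    have h := Ring.choose_succ_succ (-(r + 1)) N
    rw [show -(r + 1) + 1 = -r by ring] at h
    rw [binomialPoly_succ (r + 1) (N + 1), mul_add, ih, binomialPoly_succ r (N + 1), h, C_add]
    ring

/-- On (1 + t)^(-r) itself the operator gives exactly r (4r + 4 - 2D)(1 + t)^(-r-1); truncation
leaves one monomial. By `laplace_tauEval` the operator is, up to |z|², the Laplacian in x after
substituting τ for t. -/
theorem binomialPoly_laplace_identity (r D : ℝ) (N : ℕ) : ∃ a : ℝ,
    C 4 * (1 + X) * derivative (derivative (binomialPoly r (N + 3)))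
        + C (2 * D) * derivative (binomialPoly r (N + 3))
      = C (r * (4 * r + 4 - 2 * D)) * binomialPoly (r + 1) (N + 1) + C a * X ^ (N + 1) := by
  refine ⟨4 * (r * (r + 1)) * Ring.choose (-(r + 1 + 1)) N
    - 2 * D * r * Ring.choose (-(r + 1)) (N + 1), ?_⟩
  rw [derivative_binomialPoly, derivative_C_mul, derivative_binomialPoly]
  have h := one_add_X_mul_binomialPoly (r + 1) N
  have e : C 4 * (1 + X) * (C (-r) * (C (-(r + 1)) * binomialPoly (r + 1 + 1) (N + 1)))
      = C (4 * (r * (r + 1))) * ((1 + X) * binomialPoly (r + 1 + 1) (N + 1)) := by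
    simp only [C_mul, C_neg]; ring
  rw [e, h, binomialPoly_succ (r + 1) (N + 1)]
  have h2 : (C 2 : ℝ[X]) = 2 := map_ofNat C 2
  have h4 : (C 4 : ℝ[X]) = 4 := map_ofNat C 4
  simp only [C_mul, C_neg, C_sub, C_add, C_1, h2, h4]
  ring

end BinomialPolynomial

/-! ### Taylor coefficients of the kernel span all polynomials -/

section KernelExpansion

open MvPolynomial

variable {d : ℕ}

/-- The coefficients of order `< N` of `G`, a polynomial with coefficients in a polynomial ring,
are annihilated by the functional `L`. -/
def VanishBelow (L : MvPolynomial (Fin d) ℝ →ₗ[ℝ] ℝ) (N : ℕ)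
    (G : MvPolynomial (Fin d) (MvPolynomial (Fin d) ℝ)) : Prop :=
  ∀ α : Fin d →₀ ℕ, α.degree < N → L (coeff α G) = 0

/-- `|z|²`. -/
noncomputable def normSqPoly (d : ℕ) : MvPolynomial (Fin d) ℝ := ∑ i, X i ^ 2

/-- `|x|² |z|² - 2 x · z`, as a polynomial in `x` over the polynomials in `z`. -/
noncomputable def tauPoly (d : ℕ) : MvPolynomial (Fin d) (MvPolynomial (Fin d) ℝ) :=
  ∑ i, (X i ^ 2 * C (normSqPoly d) - 2 * X i * C (X i))

/-- Substitution of `tauPoly` into a univariate polynomial. -/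
noncomputable def tauEval (d : ℕ) (P : Polynomial ℝ) :
    MvPolynomial (Fin d) (MvPolynomial (Fin d) ℝ) :=
  Polynomial.aeval (tauPoly d) (P.map (C : ℝ →+* MvPolynomial (Fin d) ℝ))

variable {L : MvPolynomial (Fin d) ℝ →ₗ[ℝ] ℝ} {N : ℕ}
  {G H : MvPolynomial (Fin d) (MvPolynomial (Fin d) ℝ)}

theorem VanishBelow.add (hG : VanishBelow L N G) (hH : VanishBelow L N H) :
    VanishBelow L N (G + H) := fun α hα => by
  rw [coeff_add, map_add, hG α hα, hH α hα, add_zero]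

theorem VanishBelow.const_mul (hG : VanishBelow L N G) (a : ℝ) :
    VanishBelow L N (C (C a) * G) := fun α hα => by
  rw [coeff_C_mul, ← smul_eq_C_mul, map_smul, hG α hα, smul_zero]

theorem VanishBelow.sub (hG : VanishBelow L N G) (hH : VanishBelow L N H) :
    VanishBelow L N (G - H) := fun α hα => by
  rw [coeff_sub, map_sub, hG α hα, hH α hα, sub_zero]

theorem VanishBelow.sum {ι : Type*} {s : Finset ι}
    {G : ι → MvPolynomial (Fin d) (MvPolynomial (Fin d) ℝ)}
    (hG : ∀ i ∈ s, VanishBelow L N (G i)) : VanishBelow L N (∑ i ∈ s, G i) := fun α hα => by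
  rw [coeff_sum, map_sum]
  exact Finset.sum_eq_zero fun i hi => hG i hi α hα

theorem VanishBelow.of_const_mul {a : ℝ} (ha : a ≠ 0) (hG : VanishBelow L N (C (C a) * G)) :
    VanishBelow L N G := by
  have := hG.const_mul a⁻¹
  rwa [← mul_assoc, ← C_mul, ← C_mul, inv_mul_cancel₀ ha, C_1, C_1, one_mul] at this

theorem VanishBelow.pderiv (hG : VanishBelow L (N + 1) G) (i : Fin d) :
    VanishBelow L N (pderiv i G) := fun α hα => by
  have h := hG (α + Finsupp.single i 1) (by simpa using hα)
  rw [coeff_pderiv]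
  have e : coeff (α + Finsupp.single i 1) G * ((α i : MvPolynomial (Fin d) ℝ) + 1)
      = ((α i : ℝ) + 1) • coeff (α + Finsupp.single i 1) G := by
    rw [smul_eq_C_mul, mul_comm]
    simp
  rw [e, map_smul, h, smul_zero]

theorem VanishBelow.X_mul (hG : VanishBelow L N G) (i : Fin d) :
    VanishBelow L N (X i * G) := fun α hα => by
  classical
  rw [coeff_X_mul']
  split_ifs with h
  · refine hG _ (lt_of_le_of_lt ?_ hα)
    exact Finsupp.degree_mono tsub_le_self
  · exact map_zero L

/-- τ has no constant term in x, so truncation errors divisible by τ^N are invisible below order N.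
-/
theorem vanishBelow_mul_tauPoly_pow (G : MvPolynomial (Fin d) (MvPolynomial (Fin d) ℝ)) (N : ℕ) :
    VanishBelow L N (G * tauPoly d ^ N) := fun α hα => by
  have hτ : tauPoly d ∈ idealOfVars (Fin d) (MvPolynomial (Fin d) ℝ) := by
    have hX : ∀ i : Fin d, (X i : MvPolynomial (Fin d) (MvPolynomial (Fin d) ℝ)) ∈
        idealOfVars (Fin d) (MvPolynomial (Fin d) ℝ) := fun i => Ideal.subset_span ⟨i, rfl⟩
    refine Ideal.sum_mem _ fun i _ => Ideal.sub_mem _ ?_ ?_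
    · exact Ideal.mul_mem_right _ _ (Ideal.pow_mem_of_mem _ (hX i) 2 two_pos)
    · exact Ideal.mul_mem_right _ _ (Ideal.mul_mem_left _ _ (hX i))
  have := (mem_pow_idealOfVars_iff' N _).1 (Ideal.mul_mem_left _ G (Ideal.pow_mem_pow hτ N)) α hα
  rw [this, map_zero]

theorem pderiv_two (i : Fin d) :
    pderiv i (2 : MvPolynomial (Fin d) (MvPolynomial (Fin d) ℝ)) = 0 :=
  (pderiv i).map_natCast 2

theorem C_C_ofNat (n : ℕ) [n.AtLeastTwo] :
    (C (C (OfNat.ofNat n)) : MvPolynomial (Fin d) (MvPolynomial (Fin d) ℝ)) = OfNat.ofNat n := by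
  rw [map_ofNat, map_ofNat]

theorem pderiv_tauPoly (i : Fin d) :
    pderiv i (tauPoly d) = 2 * X i * C (normSqPoly d) - 2 * C (X i) := by
  classical
  simp only [tauPoly, map_sum, map_sub, Derivation.leibniz, pderiv_C, pderiv_X, smul_eq_mul,
    Derivation.leibniz_pow, pderiv_two]
  rw [Finset.sum_eq_single i]
  · simp
    ring
  · intro j _ hj
    simp [hj]
  · simp

/-- |∇τ|² = 4|z|²(1 + τ) makes functions of τ stable under the Laplacian, up to the factor |z|². -/
theorem sum_sq_pderiv_tauPoly :
    ∑ i, pderiv i (tauPoly d) ^ 2 = C (C 4) * C (normSqPoly d) * (1 + tauPoly d) := by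
  have h4 : (C (C 4) : MvPolynomial (Fin d) (MvPolynomial (Fin d) ℝ)) = 4 := C_C_ofNat 4
  have hs : (C (normSqPoly d) : MvPolynomial (Fin d) (MvPolynomial (Fin d) ℝ))
      = ∑ i, C (X i) ^ 2 := by simp [normSqPoly]
  rw [mul_add, mul_one, h4]
  simp only [pderiv_tauPoly]
  nth_rewrite 2 [hs]
  rw [tauPoly, Finset.mul_sum, Finset.mul_sum, ← Finset.sum_add_distrib]
  refine Finset.sum_congr rfl fun i _ => ?_
  ring

theorem sum_pderiv_pderiv_tauPoly :
    ∑ i, pderiv i (pderiv i (tauPoly d)) = C (C (2 * (d : ℝ))) * C (normSqPoly d) := by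
  have h : ∀ i : Fin d, pderiv i (pderiv i (tauPoly d)) = 2 * C (normSqPoly d) := fun i => by
    rw [pderiv_tauPoly, map_sub]
    simp [Derivation.leibniz, mul_comm, pderiv_two]
  simp only [h, Finset.sum_const, Finset.card_univ, Fintype.card_fin, nsmul_eq_mul, C_mul,
    map_natCast]
  rw [show (C (C (2 : ℝ)) : MvPolynomial (Fin d) (MvPolynomial (Fin d) ℝ)) = 2 from C_C_ofNat 2]
  ring

theorem pderiv_tauEval (i : Fin d) (P : Polynomial ℝ) :
    pderiv i (tauEval d P) = tauEval d (Polynomial.derivative P) * pderiv i (tauPoly d) := by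
  rw [tauEval, Derivation.map_aeval, smul_eq_mul, Polynomial.derivative_map, tauEval]

theorem tauEval_add (P Q : Polynomial ℝ) : tauEval d (P + Q) = tauEval d P + tauEval d Q := by
  simp [tauEval]

theorem tauEval_mul (P Q : Polynomial ℝ) : tauEval d (P * Q) = tauEval d P * tauEval d Q := by
  simp [tauEval]

theorem tauEval_C (a : ℝ) : tauEval d (Polynomial.C a) = C (C a) := by
  simp [tauEval, algebraMap_eq]

theorem tauEval_X : tauEval d Polynomial.X = tauPoly d := by
  simp [tauEval]

theorem tauEval_one : tauEval d 1 = 1 := by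
  simp [tauEval]

theorem tauEval_X_pow (n : ℕ) : tauEval d (Polynomial.X ^ n) = tauPoly d ^ n := by
  simp [tauEval]

theorem laplace_tauEval (P : Polynomial ℝ) :
    ∑ i, pderiv i (pderiv i (tauEval d P)) = C (normSqPoly d) *
      tauEval d (Polynomial.C 4 * (1 + Polynomial.X) * Polynomial.derivative
        (Polynomial.derivative P) + Polynomial.C (2 * (d : ℝ)) * Polynomial.derivative P) := by
  have h : ∀ i, pderiv i (pderiv i (tauEval d P))
      = tauEval d (Polynomial.derivative (Polynomial.derivative P)) * pderiv i (tauPoly d) ^ 2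
        + tauEval d (Polynomial.derivative P) * pderiv i (pderiv i (tauPoly d)) := fun i => by
    rw [pderiv_tauEval, Derivation.leibniz, pderiv_tauEval, smul_eq_mul, smul_eq_mul]
    ring
  simp only [h]
  rw [Finset.sum_add_distrib, ← Finset.mul_sum, ← Finset.mul_sum, sum_sq_pderiv_tauPoly,
    sum_pderiv_pderiv_tauPoly]
  simp only [tauEval_add, tauEval_mul, tauEval_C, tauEval_one, tauEval_X]
  ring

theorem pderiv_C_mul' (i : Fin d) (q : MvPolynomial (Fin d) ℝ)
    (G : MvPolynomial (Fin d) (MvPolynomial (Fin d) ℝ)) :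
    pderiv i (C q * G) = C q * pderiv i G := by
  simp [Derivation.leibniz]

/-- `L` annihilates the Taylor coefficients in `x` of `q(z) (1 - 2 x · z + |x|² |z|²)^(-r)`. -/
def KillsKernel (L : MvPolynomial (Fin d) ℝ →ₗ[ℝ] ℝ) (r : ℝ) (q : MvPolynomial (Fin d) ℝ) : Prop :=
  ∀ N, VanishBelow L N (C q * tauEval d (binomialPoly r N))

/-- Apply the Laplacian in x; the condition relating d and r makes its factor r (4r + 4 - 2d)
nonzero. -/
theorem KillsKernel.normSq_mul {r : ℝ} {q : MvPolynomial (Fin d) ℝ} (h : KillsKernel L r q)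
    (hr : 0 < r) (hd : (d : ℝ) < 2 * r + 2) : KillsKernel L (r + 1) (normSqPoly d * q) := by
  intro N
  rcases N with _ | N
  · exact fun α hα => absurd hα (Nat.not_lt_zero _)
  obtain ⟨a, ha⟩ := binomialPoly_laplace_identity r d N
  -- Two derivatives lower the order from N + 3 to N + 1.
  have h1 : VanishBelow L (N + 1)
      (∑ i, pderiv i (pderiv i (C q * tauEval d (binomialPoly r (N + 3))))) :=
    VanishBelow.sum fun i _ => ((h (N + 3)).pderiv i).pderiv i
  simp only [pderiv_C_mul', ← Finset.mul_sum] at h1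
  rw [laplace_tauEval, ha, tauEval_add, tauEval_mul, tauEval_mul, tauEval_C, tauEval_C,
    tauEval_X_pow] at h1
  have hne : r * (4 * r + 4 - 2 * (d : ℝ)) ≠ 0 := by
    have : 0 < 4 * r + 4 - 2 * (d : ℝ) := by linarith
    positivity
  refine VanishBelow.of_const_mul hne ?_
  convert! h1.sub (vanishBelow_mul_tauPoly_pow (C q * C (normSqPoly d) * C (C a)) (N + 1)) using 1
  simp only [C_mul]
  ring

/-- ∂_i (1 + τ)^(-r) = 2r (z_i - x_i |z|²)(1 + τ)^(-r-1), and the term with |z|² is killed by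
`KillsKernel.normSq_mul`. -/
theorem KillsKernel.X_mul {r : ℝ} {q : MvPolynomial (Fin d) ℝ} (h : KillsKernel L r q)
    (hr : 0 < r) (hd : (d : ℝ) < 2 * r + 2) (i : Fin d) : KillsKernel L (r + 1) (q * X i) := by
  intro N
  have h1 := (h (N + 1)).pderiv i
  have h2 := (((h.normSq_mul hr hd) N).X_mul i).const_mul (2 * r)
  rw [pderiv_C_mul', pderiv_tauEval, derivative_binomialPoly, tauEval_mul, tauEval_C,
    pderiv_tauPoly] at h1
  refine VanishBelow.of_const_mul (a := 2 * r) (by positivity) ?_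
  convert! h1.add h2 using 1
  simp only [C_mul, C_neg]
  have h2 : (C (C (2 : ℝ)) : MvPolynomial (Fin d) (MvPolynomial (Fin d) ℝ)) = 2 := C_C_ofNat 2
  rw [h2]
  ring

/-- Since `2 r ≥ d`, the derivatives of `|y|^(-2r)` span all functions `|y|^(-2r) z^α`,
`z = y / |y|²`. -/
theorem KillsKernel.eq_zero {r : ℝ} (h : KillsKernel L r 1) (hr : 0 < r) (hd : (d : ℝ) ≤ 2 * r) :
    L = 0 := by
  have key : ∀ (s : Fin d →₀ ℕ) (a : ℝ), ∃ k : ℕ, KillsKernel L (r + k) (monomial s a) := by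
    refine induction_on_monomial (motive := fun q => ∃ k : ℕ, KillsKernel L (r + k) q) ?_ ?_
    · refine fun a => ⟨0, fun N => ?_⟩
      have := (h N).const_mul a
      simpa using this
    · rintro q i ⟨k, hk⟩
      refine ⟨k + 1, ?_⟩
      have hk0 : (0 : ℝ) ≤ k := by positivity
      have := hk.X_mul (by linarith) (by linarith) i
      rw [add_assoc] at this
      convert this using 2
      push_cast
      rfl
  ext s
  obtain ⟨k, hk⟩ := key s 1
  -- The order-zero coefficient of the expansion truncated at N = 1 is the monomial itself.
  have := hk 1 0 (by simp)
  rw [show binomialPoly (r + k) 1 = 1 by simp [binomialPoly], tauEval_one, mul_one,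
    coeff_zero_C] at this
  exact this

end KernelExpansion

/-! ### Flat polynomials have no low-order coefficients -/

section Flatness

open MvPolynomial

theorem polynomial_coeff_eq_zero_of_flat {p : Polynomial ℝ} {N : ℕ} {C ρ : ℝ} (hρ : 0 < ρ)
    (h : ∀ t : ℝ, |t| < ρ → |p.eval t| ≤ C * |t| ^ N) {n : ℕ} (hn : n < N) : p.coeff n = 0 := by
  induction n using Nat.strong_induction_on with
  | _ n ih =>
    obtain ⟨q, hq⟩ : Polynomial.X ^ n ∣ p :=
      Polynomial.X_pow_dvd_iff.2 fun k hk => ih k hk (hk.trans hn)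
    have hc : p.coeff n = q.eval 0 := by
      rw [hq, ← Polynomial.coeff_zero_eq_eval_zero]
      simpa using Polynomial.coeff_X_pow_mul q n 0
    rw [hc]
    have h1 : Tendsto (fun t => |q.eval t|) (𝓝[≠] 0) (𝓝 |q.eval 0|) :=
      (q.continuous.abs.tendsto 0).mono_left nhdsWithin_le_nhds
    have h2 : Tendsto (fun t : ℝ => C * |t| ^ (N - n)) (𝓝[≠] 0) (𝓝 0) := by
      have : Tendsto (fun t : ℝ => C * |t| ^ (N - n)) (𝓝 0) (𝓝 (C * |0| ^ (N - n))) :=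
        Continuous.tendsto (by fun_prop) 0
      rw [abs_zero, zero_pow (by omega), mul_zero] at this
      exact this.mono_left nhdsWithin_le_nhds
    have h3 : |q.eval 0| ≤ 0 := by
      refine le_of_tendsto_of_tendsto h1 h2 ?_
      have hb : ∀ᶠ t : ℝ in 𝓝[≠] 0, |t| < ρ :=
        (((continuous_abs.tendsto (0 : ℝ)).eventually_lt_const (by simpa using hρ))).filter_mono
          nhdsWithin_le_nhds
      filter_upwards [hb, self_mem_nhdsWithin] with t ht ht0
      have ht0' : 0 < |t| := abs_pos.2 ht0
      have := h t ht
      rw [hq, Polynomial.eval_mul, Polynomial.eval_pow, Polynomial.eval_X, abs_mul, abs_pow,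
        show N = n + (N - n) by omega, pow_add, mul_left_comm] at this
      exact le_of_mul_le_mul_left (by simpa using this) (pow_pos ht0' n)
    exact abs_nonpos_iff.1 h3

/-- On the line t ↦ t x the homogeneous components become coefficients of a polynomial in t. -/
theorem coeff_eq_zero_of_flat {d : ℕ} {P : MvPolynomial (Fin d) ℝ} {N : ℕ} {C ρ : ℝ} (hρ : 0 < ρ)
    (h : ∀ x : EuclideanSpace ℝ (Fin d), ‖x‖ < ρ → |eval (fun i => x i) P| ≤ C * ‖x‖ ^ N)
    (α : Fin d →₀ ℕ) (hα : α.degree < N) : coeff α P = 0 := by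
  have key : homogeneousComponent α.degree P = 0 := by
    refine MvPolynomial.funext fun y => ?_
    rw [map_zero]
    set x : EuclideanSpace ℝ (Fin d) := WithLp.toLp 2 y
    set p : Polynomial ℝ := ∑ n ∈ Finset.range (P.totalDegree + 1),
      Polynomial.C (eval y (homogeneousComponent n P)) * Polynomial.X ^ n
    have hp : ∀ t : ℝ, p.eval t = eval (fun i => (t • x) i) P := by
      intro t
      conv_rhs => rw [← sum_homogeneousComponent P]
      simp only [p, Polynomial.eval_finsetSum, map_sum, Polynomial.eval_mul, Polynomial.eval_C,
        Polynomial.eval_pow, Polynomial.eval_X]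
      refine Finset.sum_congr rfl fun n _ => ?_
      have hh := homogeneousComponent_isHomogeneous n P
      have e : (fun i => (t • x) i) = t • y := rfl
      rw [e, eval_eq, eval_eq, Finset.sum_mul]
      refine Finset.sum_congr rfl fun β hβ => ?_
      have hdeg : β.degree = n := by
        by_contra hne
        rw [mem_support_iff, coeff_homogeneousComponent, if_neg hne] at hβ
        exact hβ rfl
      simp only [Pi.smul_apply, smul_eq_mul, mul_pow, Finset.prod_mul_distrib]
      rw [Finset.prod_pow_eq_pow_sum, ← Finsupp.degree_apply, hdeg]
      ring
    have hcoeff : p.coeff α.degree = 0 := by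
      refine polynomial_coeff_eq_zero_of_flat (N := N) (C := C * ‖x‖ ^ N)
        (ρ := ρ / (‖x‖ + 1)) (by positivity) (fun t ht => ?_) hα
      rw [lt_div_iff₀ (by positivity)] at ht
      rw [hp]
      refine (h (t • x) ?_).trans_eq ?_
      · rw [norm_smul, Real.norm_eq_abs]
        nlinarith [abs_nonneg t, norm_nonneg x]
      · rw [norm_smul, Real.norm_eq_abs, mul_pow]; ring
    simp only [p, Polynomial.finsetSum_coeff, Polynomial.coeff_C_mul_X_pow] at hcoeff
    rw [Finset.sum_ite_eq] at hcoeff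
    split_ifs at hcoeff with hmem
    · exact hcoeff
    · rw [homogeneousComponent_eq_zero, map_zero]
      simpa [Nat.lt_succ_iff] using hmem
  have := congrArg (coeff α) key
  rwa [coeff_homogeneousComponent, if_pos rfl, coeff_zero] at this

end Flatness

/-! ### Remainder of the binomial expansion -/

section Remainder

theorem binomialPoly_isBigO (r : ℝ) (N : ℕ) :
    (fun t : ℝ => (1 + t) ^ (-r) - (binomialPoly r N).eval t) =O[𝓝 0] fun t => |t| ^ N := by
  have h := (Real.one_add_rpow_hasFPowerSeriesAt_zero (a := -r)).isBigO_sub_partialSum_pow N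
  simp only [zero_add, Real.norm_eq_abs] at h
  refine h.congr_left fun t => ?_
  congr 1
  rw [FormalMultilinearSeries.partialSum, binomialPoly, Polynomial.eval_finsetSum]
  refine Finset.sum_congr rfl fun j _ => ?_
  rw [binomialSeries_apply]
  simp

/-- Away from ρ = 0 only the degree matters: max(1, |t|) ≤ (ρ/δ)(ρ + 2), and all exponents are below
N. -/
theorem exists_abs_eval_binomialPoly_le (r : ℝ) (N : ℕ) {δ : ℝ} (hδ : 0 < δ) (hδ1 : δ ≤ 1) :
    ∃ C : ℝ, 0 ≤ C ∧ ∀ ρ t : ℝ, δ ≤ ρ → |t| ≤ ρ ^ 2 + 2 * ρ →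
      |(binomialPoly r N).eval t| ≤ C * (ρ ^ N * (1 + ρ ^ N)) := by
  set S := ∑ j ∈ Finset.range N, |Ring.choose (-r) j|
  have hS : 0 ≤ S := Finset.sum_nonneg fun _ _ => abs_nonneg _
  refine ⟨S * (3 / δ) ^ N, by positivity, fun ρ t hρ ht => ?_⟩
  have hρ0 : 0 < ρ := hδ.trans_le hρ
  have h1 : (1 : ℝ) ≤ ρ / δ := by rwa [one_le_div hδ]
  have hm : max 1 |t| ≤ ρ / δ * (ρ + 2) := by
    refine max_le (by nlinarith) (ht.trans ?_)
    have : ρ ≤ ρ / δ := by rw [le_div_iff₀ hδ]; nlinarith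
    nlinarith
  have h2 : (ρ + 2) ^ N ≤ 3 ^ N * (1 + ρ ^ N) := by
    have : ρ + 2 ≤ 3 * max 1 ρ := by
      linarith [le_max_left 1 ρ, le_max_right 1 ρ]
    calc (ρ + 2) ^ N ≤ (3 * max 1 ρ) ^ N := by gcongr
      _ = 3 ^ N * max 1 ρ ^ N := mul_pow _ _ _
      _ ≤ 3 ^ N * (1 + ρ ^ N) := by
          gcongr
          rcases max_cases 1 ρ with ⟨e, _⟩ | ⟨e, _⟩ <;> rw [e]
          · rw [one_pow]; linarith [pow_pos hρ0 N]
          · linarith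
  calc |(binomialPoly r N).eval t|
      ≤ ∑ j ∈ Finset.range N, |Ring.choose (-r) j| * |t| ^ j := by
        rw [binomialPoly, Polynomial.eval_finsetSum]
        refine (Finset.abs_sum_le_sum_abs _ _).trans_eq ?_
        simp [abs_mul]
    _ ≤ ∑ j ∈ Finset.range N, |Ring.choose (-r) j| * max 1 |t| ^ N := by
        refine Finset.sum_le_sum fun j hj => ?_
        gcongr
        calc |t| ^ j ≤ max 1 |t| ^ j := by gcongr; exact le_max_right _ _
          _ ≤ max 1 |t| ^ N := pow_le_pow_right₀ (le_max_left _ _) (Finset.mem_range.1 hj).le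
    _ = S * max 1 |t| ^ N := by rw [Finset.sum_mul]
    _ ≤ S * (ρ / δ * (ρ + 2)) ^ N := by gcongr
    _ = S * (ρ / δ) ^ N * (ρ + 2) ^ N := by rw [mul_pow]; ring
    _ ≤ S * (ρ / δ) ^ N * (3 ^ N * (1 + ρ ^ N)) := by gcongr
    _ = _ := by rw [div_pow, div_pow]; ring

/-- Remainder of the expansion of `(1 + t)^(-r)`, `1 + t = |x - y|² / |y|²`, `ρ = |x| / |y|`. -/
theorem exists_abs_rpow_sub_binomialPoly_le {r : ℝ} (hr : 0 < r) (N : ℕ) :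
    ∃ C : ℝ, 0 ≤ C ∧ ∀ ρ t : ℝ, 0 ≤ ρ → |t| ≤ ρ ^ 2 + 2 * ρ → ρ ^ 2 / 4 ≤ 1 + t →
      |(1 + t) ^ (-r) - (binomialPoly r N).eval t| ≤ C * (ρ ^ N * (1 + ρ ^ N)) := by
  obtain ⟨C₁, hC₁, hO⟩ := (binomialPoly_isBigO r N).exists_pos
  obtain ⟨η, hη, hball⟩ := Metric.eventually_nhds_iff.1 hO.bound
  set δ := min 1 (η / 4)
  have hδ : 0 < δ := by positivity
  obtain ⟨C₂, hC₂, hP⟩ := exists_abs_eval_binomialPoly_le r N hδ (min_le_left _ _)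
  refine ⟨C₁ * 3 ^ N + (δ ^ 2 / 4) ^ (-r) * (1 / δ) ^ N + C₂, by positivity,
    fun ρ t hρ ht hlow => ?_⟩
  have hX : 0 ≤ ρ ^ N * (1 + ρ ^ N) := by positivity
  -- Small ρ is Taylor's formula. For ρ ≥ δ both terms are bounded separately, the lower bound on 1
  -- + t excluding the singularity.
  rcases lt_or_ge ρ δ with hs | hb
  · have h1 : ρ ≤ 1 := hs.le.trans (min_le_left _ _)
    have h4 : ρ < η / 4 := hs.trans_le (min_le_right _ _)
    have ht3 : |t| ≤ 3 * ρ := by nlinarith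
    have h := hball (y := t) (by rw [dist_zero_right, Real.norm_eq_abs]; linarith)
    rw [Real.norm_eq_abs, norm_pow, Real.norm_eq_abs, abs_abs] at h
    calc _ ≤ C₁ * |t| ^ N := h
      _ ≤ C₁ * (3 * ρ) ^ N := by gcongr
      _ = C₁ * 3 ^ N * (ρ ^ N * 1) := by rw [mul_pow]; ring
      _ ≤ C₁ * 3 ^ N * (ρ ^ N * (1 + ρ ^ N)) := by
          gcongr; linarith [pow_nonneg hρ N]
      _ ≤ _ := by
          have : 0 ≤ (δ ^ 2 / 4) ^ (-r) * (1 / δ) ^ N := by positivity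
          gcongr
          linarith
  · have h1 : (1 + t) ^ (-r) ≤ (δ ^ 2 / 4) ^ (-r) * (1 / δ) ^ N * (ρ ^ N * (1 + ρ ^ N)) := by
      have hd : δ ^ 2 / 4 ≤ 1 + t := by
        refine le_trans ?_ hlow
        gcongr
      have h2 : (1 + t) ^ (-r) ≤ (δ ^ 2 / 4) ^ (-r) :=
        Real.rpow_le_rpow_of_nonpos (by positivity) hd (by linarith)
      have h3 : (1 : ℝ) ≤ (1 / δ) ^ N * ρ ^ N := by
        rw [← mul_pow]
        refine one_le_pow₀ ?_
        rw [one_div, ← div_eq_inv_mul]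
        rwa [one_le_div hδ]
      calc _ ≤ (δ ^ 2 / 4) ^ (-r) * (1 * 1) := by rwa [mul_one, mul_one]
        _ ≤ (δ ^ 2 / 4) ^ (-r) * (((1 / δ) ^ N * ρ ^ N) * (1 + ρ ^ N)) := by
            gcongr
            linarith [pow_nonneg hρ N]
        _ = _ := by ring
    have hpos : 0 ≤ (1 + t) ^ (-r) := Real.rpow_nonneg (by nlinarith [sq_nonneg ρ]) _
    calc _ ≤ (1 + t) ^ (-r) + |(binomialPoly r N).eval t| := by
          refine (abs_sub _ _).trans_eq ?_
          rw [abs_of_nonneg hpos]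
      _ ≤ (δ ^ 2 / 4) ^ (-r) * (1 / δ) ^ N * (ρ ^ N * (1 + ρ ^ N))
          + C₂ * (ρ ^ N * (1 + ρ ^ N)) := add_le_add h1 (hP ρ t hb ht)
      _ ≤ _ := by
          have : 0 ≤ C₁ * 3 ^ N * (ρ ^ N * (1 + ρ ^ N)) := by positivity
          linarith

end Remainder

/-! ### Inversion and the kernel |x - y|^(-2r) -/

section Inversion

variable {d : ℕ}

/-- The inversion `y ↦ y / |y|²`. -/
noncomputable def sphereInv (y : EuclideanSpace ℝ (Fin d)) : EuclideanSpace ℝ (Fin d) :=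
  (‖y‖ ^ 2)⁻¹ • y

theorem measurable_sphereInv : Measurable (sphereInv (d := d)) := by
  unfold sphereInv
  fun_prop

theorem norm_sphereInv (y : EuclideanSpace ℝ (Fin d)) : ‖sphereInv y‖ = ‖y‖⁻¹ := by
  rcases eq_or_ne y 0 with rfl | hy
  · simp [sphereInv]
  · have := norm_pos_iff.2 hy
    rw [sphereInv, norm_smul, norm_inv, norm_pow, norm_norm]
    field_simp

theorem sphereInv_sphereInv (y : EuclideanSpace ℝ (Fin d)) : sphereInv (sphereInv y) = y := by
  rcases eq_or_ne y 0 with rfl | hy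
  · simp [sphereInv]
  · have := norm_pos_iff.2 hy
    rw [sphereInv, norm_sphereInv, sphereInv, smul_smul]
    rw [show (‖y‖⁻¹ ^ 2)⁻¹ * (‖y‖ ^ 2)⁻¹ = 1 by field_simp, one_smul]

theorem sphereInv_apply (y : EuclideanSpace ℝ (Fin d)) (i : Fin d) :
    sphereInv y i = (‖y‖ ^ 2)⁻¹ * y i := rfl

/-- `|x|² |z|² - 2 x · z`. -/
noncomputable def tau (x z : EuclideanSpace ℝ (Fin d)) : ℝ := ‖x‖ ^ 2 * ‖z‖ ^ 2 - 2 * inner ℝ x z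

theorem abs_tau_le (x z : EuclideanSpace ℝ (Fin d)) :
    |tau x z| ≤ (‖x‖ * ‖z‖) ^ 2 + 2 * (‖x‖ * ‖z‖) := by
  have h := abs_real_inner_le_norm x z
  calc |tau x z| ≤ |‖x‖ ^ 2 * ‖z‖ ^ 2| + |2 * inner ℝ x z| := abs_sub _ _
    _ = ‖x‖ ^ 2 * ‖z‖ ^ 2 + 2 * |inner ℝ x z| := by
        rw [abs_mul 2, abs_two, abs_of_nonneg (by positivity)]
    _ ≤ ‖x‖ ^ 2 * ‖z‖ ^ 2 + 2 * (‖x‖ * ‖z‖) := by gcongr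
    _ = _ := by ring

theorem one_add_tau_sphereInv (x : EuclideanSpace ℝ (Fin d)) {y : EuclideanSpace ℝ (Fin d)}
    (hy : y ≠ 0) : 1 + tau x (sphereInv y) = (‖x - y‖ / ‖y‖) ^ 2 := by
  have := norm_pos_iff.2 hy
  rw [tau, norm_sphereInv, sphereInv, inner_smul_right, div_pow, norm_sub_sq_real]
  field_simp
  ring

/-- Here ρ = |x||z|. One factor |x|^N is kept and a second is bounded by 1; the rest is a majorant
in y controlled by finite moments. -/
theorem exists_kernel_remainder_le {r : ℝ} (hr : 0 < r) (N : ℕ) :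
    ∃ C : ℝ, 0 ≤ C ∧ ∀ x y : EuclideanSpace ℝ (Fin d), ‖x‖ ≤ 1 → y ≠ 0 → ‖x‖ / 2 ≤ ‖x - y‖ →
      |(‖x - y‖ ^ (2 * r))⁻¹ - (‖y‖ ^ (2 * r))⁻¹ * (binomialPoly r N).eval (tau x (sphereInv y))|
        ≤ C * ‖x‖ ^ N * ((‖sphereInv y‖ ^ N + ‖sphereInv y‖ ^ (2 * N)) * (‖y‖ ^ (2 * r))⁻¹) := by
  obtain ⟨C, hC, h⟩ := exists_abs_rpow_sub_binomialPoly_le hr N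
  refine ⟨C, hC, fun x y hx hy hxy => ?_⟩
  have hy' := norm_pos_iff.2 hy
  set z := sphereInv y
  have hz : ‖z‖ = ‖y‖⁻¹ := norm_sphereInv y
  have e := one_add_tau_sphereInv x hy
  have h1 := h (‖x‖ * ‖z‖) (tau x z) (by positivity) (abs_tau_le x z) (by
    rw [e, hz, ← div_eq_mul_inv, div_pow, div_pow, div_right_comm]
    gcongr
    nlinarith [norm_nonneg x])
  have e2 : (1 + tau x z) ^ (-r) = ‖y‖ ^ (2 * r) * (‖x - y‖ ^ (2 * r))⁻¹ := by
    rw [e, ← Real.rpow_natCast, ← Real.rpow_mul (by positivity), Nat.cast_ofNat, mul_neg,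
      Real.rpow_neg (by positivity), Real.div_rpow (by positivity) hy'.le, inv_div, div_eq_mul_inv]
  have hyr : 0 < ‖y‖ ^ (2 * r) := Real.rpow_pos_of_pos hy' _
  have e3 : (‖x - y‖ ^ (2 * r))⁻¹ - (‖y‖ ^ (2 * r))⁻¹ * (binomialPoly r N).eval (tau x z)
      = (‖y‖ ^ (2 * r))⁻¹ * ((1 + tau x z) ^ (-r) - (binomialPoly r N).eval (tau x z)) := by
    rw [e2, mul_sub, ← mul_assoc, inv_mul_cancel₀ hyr.ne', one_mul]
  rw [e3, abs_mul, abs_of_pos (inv_pos.2 hyr)]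
  have h2 : (‖x‖ * ‖z‖) ^ N * (1 + (‖x‖ * ‖z‖) ^ N)
      ≤ ‖x‖ ^ N * (‖z‖ ^ N + ‖z‖ ^ (2 * N)) := by
    have : ‖x‖ ^ N ≤ 1 := pow_le_one₀ (norm_nonneg x) hx
    calc (‖x‖ * ‖z‖) ^ N * (1 + (‖x‖ * ‖z‖) ^ N)
        = ‖x‖ ^ N * (‖z‖ ^ N * (1 + ‖x‖ ^ N * ‖z‖ ^ N)) := by rw [mul_pow]; ring
      _ ≤ ‖x‖ ^ N * (‖z‖ ^ N * (1 + 1 * ‖z‖ ^ N)) := by gcongr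
      _ = _ := by ring
  calc _ ≤ (‖y‖ ^ (2 * r))⁻¹ * (C * (‖x‖ ^ N * (‖z‖ ^ N + ‖z‖ ^ (2 * N)))) := by
        gcongr
        exact h1.trans (by gcongr)
    _ = _ := by ring

/-- The Taylor polynomial is later integrated over all y, including the ball B(x, |x|/2) that the
kernel avoids. There |x||z| ≥ 1/2, so the polynomial is small of order N anyway. -/
theorem exists_abs_eval_binomialPoly_tau_le (r : ℝ) (N : ℕ) :
    ∃ C : ℝ, 0 ≤ C ∧ ∀ x y : EuclideanSpace ℝ (Fin d), ‖x‖ ≤ 1 → y ≠ 0 → ‖x - y‖ < ‖x‖ / 2 →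
      |(binomialPoly r N).eval (tau x (sphereInv y))|
        ≤ C * ‖x‖ ^ N * (‖sphereInv y‖ ^ N + ‖sphereInv y‖ ^ (2 * N)) := by
  obtain ⟨C, hC, h⟩ := exists_abs_eval_binomialPoly_le r N (δ := 1 / 2) (by norm_num) (by norm_num)
  refine ⟨C, hC, fun x y hx hy hxy => ?_⟩
  have hy' := norm_pos_iff.2 hy
  set z := sphereInv y
  have hz : ‖z‖ = ‖y‖⁻¹ := norm_sphereInv y
  have hyx : ‖y‖ ≤ 2 * ‖x‖ := by
    have h1 := norm_le_norm_add_norm_sub x y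
    have h2 := norm_nonneg x
    linarith
  have h1 := h (‖x‖ * ‖z‖) (tau x z) (by
    rw [hz, ← div_eq_mul_inv, div_le_div_iff₀ two_pos hy']; linarith) (abs_tau_le x z)
  refine h1.trans ?_
  have : ‖x‖ ^ N ≤ 1 := pow_le_one₀ (norm_nonneg x) hx
  calc C * ((‖x‖ * ‖z‖) ^ N * (1 + (‖x‖ * ‖z‖) ^ N))
      = C * (‖x‖ ^ N * (‖z‖ ^ N * (1 + ‖x‖ ^ N * ‖z‖ ^ N))) := by rw [mul_pow]; ring
    _ ≤ C * (‖x‖ ^ N * (‖z‖ ^ N * (1 + 1 * ‖z‖ ^ N))) := by gcongr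
    _ = _ := by ring

end Inversion

/-! ### From flatness in x to vanishing moments -/

section MomentFunctional

open MvPolynomial

variable {d : ℕ} {Y : Type*} [MeasurableSpace Y] {m : Measure Y}
  {z : Y → EuclideanSpace ℝ (Fin d)} {ω : Y → ℝ}

/-- The functional `q ↦ ∫ q(z) ω`. -/
noncomputable def momentFunctional (hz : Measurable z)
    (hω : ∀ n : ℕ, Integrable (fun y => ‖z y‖ ^ n * ω y) m) : MvPolynomial (Fin d) ℝ →ₗ[ℝ] ℝ where
  toFun q := ∫ y, eval (fun i => z y i) q * ω y ∂m
  map_add' q q' := by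
    rw [← integral_add (integrable_eval_mul hz hω q) (integrable_eval_mul hz hω q')]
    simp only [map_add, add_mul]
  map_smul' a q := by
    simp only [smul_eval, RingHom.id_apply, smul_eq_mul, mul_assoc, integral_const_mul]

theorem eval_eval_tauEval (P : Polynomial ℝ) (x z : EuclideanSpace ℝ (Fin d)) :
    eval (fun i => z i) (eval (fun i => C (x i)) (tauEval d P)) = P.eval (tau x z) := by
  have h : (eval (fun i => z i)) (eval (fun i => C (x i)) (tauPoly d)) = tau x z := by
    simp only [tauPoly, normSqPoly, tau, map_sum, map_sub, map_mul, map_pow, eval_X, eval_C,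
      map_ofNat]
    rw [Finset.sum_sub_distrib, ← Finset.sum_mul, EuclideanSpace.real_norm_sq_eq,
      EuclideanSpace.real_norm_sq_eq, PiLp.inner_apply, Finset.mul_sum]
    simp [mul_assoc, mul_comm, Finset.mul_sum]
  induction P using Polynomial.induction_on' with
  | add P Q hP hQ => rw [tauEval_add, map_add, map_add, hP, hQ, Polynomial.eval_add]
  | monomial n a =>
    rw [← Polynomial.C_mul_X_pow_eq_monomial, tauEval_mul, tauEval_C, tauEval_X_pow]
    simp only [map_mul, map_pow, eval_C, h, Polynomial.eval_mul, Polynomial.eval_C,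
      Polynomial.eval_pow, Polynomial.eval_X]

/-- Applying L to the coefficients gives a real polynomial in x. The a.e. bound on it extends to
every x in the ball by density and continuity. -/
theorem vanishBelow_of_flat {L : MvPolynomial (Fin d) ℝ →ₗ[ℝ] ℝ}
    {G : MvPolynomial (Fin d) (MvPolynomial (Fin d) ℝ)} {N : ℕ} {K ρ : ℝ} (hρ : 0 < ρ)
    (h : ∀ᵐ x : EuclideanSpace ℝ (Fin d), ‖x‖ < ρ →
      |L (eval (fun i => C (x i)) G)| ≤ K * ‖x‖ ^ N) : VanishBelow L N G := by
  classical
  intro α hα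
  set P : MvPolynomial (Fin d) ℝ := ∑ β ∈ G.support, monomial β (L (coeff β G))
  have hP : coeff α P = L (coeff α G) := by
    simp only [P, coeff_sum, coeff_monomial]
    rw [Finset.sum_ite_eq']
    split_ifs with hmem
    · rfl
    · rw [notMem_support_iff.1 hmem, map_zero]
  have hev : ∀ x : Fin d → ℝ, eval x P = L (eval (fun i => C (x i)) G) := by
    intro x
    rw [eval_eq (fun i => C (x i)) G, map_sum]
    simp only [map_sum]
    refine Finset.sum_congr rfl fun β _ => ?_
    rw [eval_monomial]
    have : coeff β G * ∏ i ∈ β.support, (C (x i) : MvPolynomial (Fin d) ℝ) ^ β i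
        = (∏ i ∈ β.support, x i ^ β i) • coeff β G := by
      rw [smul_eq_C_mul, map_prod, mul_comm]
      simp only [map_pow]
    rw [this, map_smul, smul_eq_mul, mul_comm]
    rfl
  rw [← hP]
  refine coeff_eq_zero_of_flat (C := K) hρ (fun x hx => ?_) α hα
  have hclosed : IsClosed {x : EuclideanSpace ℝ (Fin d) |
      |eval (fun i => x i) P| ≤ K * ‖x‖ ^ N} := by
    refine isClosed_le (Continuous.abs ?_) (by fun_prop)
    exact (continuous_eval P).comp (by fun_prop)
  have hdense := (Measure.dense_of_ae h).open_subset_closure_inter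
    (Metric.isOpen_ball (x := (0 : EuclideanSpace ℝ (Fin d))) (ε := ρ))
  refine hclosed.closure_subset_iff.2 ?_ (hdense (mem_ball_zero_iff.2 hx))
  rintro y ⟨hy1, hy2⟩
  rw [Set.mem_ofPred_eq, hev]
  exact hy2 (mem_ball_zero_iff.1 hy1)

/-- If `∫ ω(y) (1 - 2 x · z + |x|² |z|²)^(-r)` is flat at `x = 0` in the sense of formal
expansions, then all moments of `ω` vanish. -/
theorem integral_eval_mul_eq_zero_of_flat (hz : Measurable z)
    (hω : ∀ n : ℕ, Integrable (fun y => ‖z y‖ ^ n * ω y) m) {r : ℝ} (hr : 0 < r)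
    (hd : (d : ℝ) ≤ 2 * r)
    (h : ∀ N : ℕ, ∃ K ρ : ℝ, 0 < ρ ∧ ∀ᵐ x : EuclideanSpace ℝ (Fin d), ‖x‖ < ρ →
      |∫ y, (binomialPoly r N).eval (tau x (z y)) * ω y ∂m| ≤ K * ‖x‖ ^ N)
    (q : MvPolynomial (Fin d) ℝ) : ∫ y, eval (fun i => z y i) q * ω y ∂m = 0 := by
  have hk : KillsKernel (momentFunctional hz hω) r 1 := by
    intro N
    obtain ⟨K, ρ, hρ, hK⟩ := h N
    refine vanishBelow_of_flat (K := K) hρ (hK.mono fun x hx hxρ => ?_)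
    refine le_trans (le_of_eq ?_) (hx hxρ)
    congr 1
    change ∫ y, _ ∂m = _
    congr with y
    rw [C_1, one_mul, eval_eval_tauEval]
  have := hk.eq_zero hr hd
  exact congrArg (fun L : MvPolynomial (Fin d) ℝ →ₗ[ℝ] ℝ => L q) this

end MomentFunctional

/-! ### Integrability of the tail density -/

section Density

variable {d : ℕ} {s p : ℝ} {u : EuclideanSpace ℝ (Fin d) → ℝ}

/-- The density `J(u(y)) / |y|^(d + s p)`. -/
noncomputable def tailDensity (s p : ℝ) (u : EuclideanSpace ℝ (Fin d) → ℝ)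
    (y : EuclideanSpace ℝ (Fin d)) : ℝ :=
  J p (u y) / ‖y‖ ^ ((d : ℝ) + s * p)

theorem measurable_J (p : ℝ) : Measurable (J p) := by
  unfold J
  fun_prop

theorem aestronglyMeasurable_J_comp (hu : AEStronglyMeasurable u volume) :
    AEStronglyMeasurable (fun y => J p (u y)) volume :=
  ((measurable_J p).comp_aemeasurable hu.aemeasurable).aestronglyMeasurable

theorem aestronglyMeasurable_tailDensity (hu : AEStronglyMeasurable u volume) :
    AEStronglyMeasurable (tailDensity s p u) volume :=
  (((measurable_J p).comp_aemeasurable hu.aemeasurable).div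
    (by fun_prop : Measurable fun y : EuclideanSpace ℝ (Fin d) =>
      ‖y‖ ^ ((d : ℝ) + s * p)).aemeasurable).aestronglyMeasurable

theorem abs_tailDensity (hp : 1 < p) (y : EuclideanSpace ℝ (Fin d)) :
    |tailDensity s p u y| = |u y| ^ (p - 1) / ‖y‖ ^ ((d : ℝ) + s * p) := by
  rw [tailDensity, abs_div, abs_J hp, abs_of_nonneg (Real.rpow_nonneg (norm_nonneg y) _)]

theorem moment_eq_lintegral (hp : 1 < p) (i : Fin d) (k : ℕ) :
    moment s p u i k
      = ∫⁻ y, ENNReal.ofReal (sphereInv y i ^ (2 * k) * |tailDensity s p u y|) := by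
  refine lintegral_congr fun y => ?_
  rw [abs_tailDensity hp, sphereInv_apply, mul_pow, inv_pow, ← pow_mul, div_eq_inv_mul]
  ring_nf

theorem measurable_sphereInv_apply (i : Fin d) : Measurable fun y => sphereInv y i := by
  have := measurable_sphereInv (d := d)
  fun_prop

theorem aestronglyMeasurable_moment_integrand (hu : AEStronglyMeasurable u volume) (i : Fin d)
    (k : ℕ) :
    AEStronglyMeasurable (fun y => sphereInv y i ^ (2 * k) * |tailDensity s p u y|) volume :=
  ((measurable_sphereInv_apply i).pow_const _).aestronglyMeasurable.mul
    (aestronglyMeasurable_tailDensity hu).norm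

theorem integrable_moment_of_lt_top (hp : 1 < p) (hu : AEStronglyMeasurable u volume) {i : Fin d}
    {k : ℕ} (h : moment s p u i k < ∞) :
    Integrable fun y => sphereInv y i ^ (2 * k) * |tailDensity s p u y| := by
  refine ⟨aestronglyMeasurable_moment_integrand hu i k, ?_⟩
  rw [hasFiniteIntegral_iff_ofReal (ae_of_all _ fun y =>
    mul_nonneg ((even_two_mul k).pow_nonneg _) (abs_nonneg _)), ← moment_eq_lintegral hp]
  exact h

theorem ae_apply_ne_zero (i : Fin d) : ∀ᵐ y : EuclideanSpace ℝ (Fin d), y i ≠ 0 := by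
  set W : Submodule ℝ (EuclideanSpace ℝ (Fin d)) :=
    LinearMap.ker (EuclideanSpace.proj i : EuclideanSpace ℝ (Fin d) →L[ℝ] ℝ).toLinearMap
  have hW : W ≠ ⊤ := by
    intro h
    have : EuclideanSpace.single i (1 : ℝ) ∈ W := h ▸ Submodule.mem_top
    simp [W] at this
  have h := Measure.addHaar_submodule (volume : Measure (EuclideanSpace ℝ (Fin d))) W hW
  refine measure_mono_null (fun y hy => ?_) h
  simpa [W] using hy

theorem ae_ne_zero (hd : 0 < d) : ∀ᵐ y : EuclideanSpace ℝ (Fin d), y ≠ 0 := by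
  filter_upwards [ae_apply_ne_zero (⟨0, hd⟩ : Fin d)] with y hy h
  simp [h] at hy

theorem eq_zero_of_tailDensity_eq_zero (hp : 1 < p) {y : EuclideanSpace ℝ (Fin d)} (hy : y ≠ 0)
    (h : tailDensity s p u y = 0) : u y = 0 := by
  have h' := abs_tailDensity (s := s) (u := u) hp y
  rw [h, abs_zero, eq_comm, div_eq_zero_iff] at h'
  have hpos := Real.rpow_pos_of_pos (norm_pos_iff.2 hy) ((d : ℝ) + s * p)
  have := h'.resolve_right hpos.ne'
  exact abs_eq_zero.1 ((Real.rpow_eq_zero (abs_nonneg _) (by linarith)).1 this)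

theorem ae_eq_zero_of_moment_eq_zero (hp : 1 < p) (hu : AEStronglyMeasurable u volume) {i : Fin d}
    {k : ℕ} (h : moment s p u i k = 0) : u =ᵐ[volume] 0 := by
  rw [moment_eq_lintegral hp, lintegral_eq_zero_iff'
    (aestronglyMeasurable_moment_integrand hu i k).aemeasurable.ennreal_ofReal] at h
  filter_upwards [h, ae_apply_ne_zero i] with y hy hyi
  have hy0 : y ≠ 0 := by
    rintro rfl
    simp at hyi
  rw [Pi.zero_apply, ENNReal.ofReal_eq_zero] at hy
  have h1 : 0 < sphereInv y i ^ (2 * k) := by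
    refine (even_two_mul k).pow_pos ?_
    rw [sphereInv_apply]
    have := norm_pos_iff.2 hy0
    positivity
  have h2 : |tailDensity s p u y| ≤ 0 := by
    by_contra hlt
    exact absurd hy (not_le.2 (mul_pos h1 (not_le.1 hlt)))
  exact eq_zero_of_tailDensity_eq_zero hp hy0 (abs_nonpos_iff.1 h2)

/-- Otherwise the Carleman series would have only finitely many nonzero terms, each finite because
no moment vanishes. -/
theorem exists_moment_lt_top (hm : CarlemanCondition s p u) {i : Fin d}
    (hpos : ∀ k, moment s p u i k ≠ 0) (K : ℕ) : ∃ k, K ≤ k ∧ moment s p u i k < ∞ := by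
  by_contra! hcon
  have hm' := hm i
  rw [tsum_eq_sum (s := Finset.range K)] at hm'
  · refine (ENNReal.sum_lt_top.2 fun k _ => ?_).ne hm'
    rw [ENNReal.inv_lt_top, pos_iff_ne_zero, Ne, ENNReal.rpow_eq_zero_iff, not_or]
    have : (0 : ℝ) < 1 / (2 * ((k : ℝ) + 1)) := by positivity
    exact ⟨fun h => hpos _ h.1, fun h => h.2.not_ge this.le⟩
  · intro k hk
    rw [Finset.mem_range, not_lt] at hk
    have : moment s p u i (k + 1) = ∞ := top_le_iff.1 (hcon (k + 1) (by omega))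
    rw [this, ENNReal.top_rpow_of_pos (by positivity), ENNReal.inv_top]

theorem tail_bound {y : EuclideanSpace ℝ (Fin d)} (hs : 0 ≤ s) (hp : 1 < p) (hy : 1 ≤ ‖y‖) :
    |tailDensity s p u y|
      ≤ 2 ^ ((d : ℝ) + s * p) * (|u y| ^ (p - 1) / (1 + ‖y‖) ^ ((d : ℝ) + s * p)) := by
  have hκ : 0 ≤ (d : ℝ) + s * p := by positivity
  have hy0 : 0 < ‖y‖ := by linarith
  have h : (1 + ‖y‖) ^ ((d : ℝ) + s * p) ≤ 2 ^ ((d : ℝ) + s * p) * ‖y‖ ^ ((d : ℝ) + s * p) := by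
    rw [← Real.mul_rpow (by norm_num) (norm_nonneg _)]
    exact Real.rpow_le_rpow (by positivity) (by linarith) hκ
  rw [abs_tailDensity hp, ← mul_div_assoc, div_le_div_iff₀ (Real.rpow_pos_of_pos hy0 _)
    (by positivity)]
  have : 0 ≤ |u y| ^ (p - 1) := by positivity
  nlinarith

/-- Some coordinate satisfies |z|² ≤ d z_i². The exponents depend on i because the finite moments
supplied by Carleman's condition do. -/
theorem norm_pow_le_sum (k : Fin d → ℕ) {n : ℕ} (hk : ∀ i, n ≤ 2 * k i)
    {z : EuclideanSpace ℝ (Fin d)} (hz : 1 ≤ ‖z‖) :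
    ‖z‖ ^ n ≤ ∑ i, (d : ℝ) ^ k i * z i ^ (2 * k i) := by
  obtain ⟨i, hi⟩ : ∃ i, ‖z‖ ^ 2 ≤ d * z i ^ 2 := by
    by_contra! hcon
    have h1 : ∑ i, (d : ℝ) * z i ^ 2 = d * ‖z‖ ^ 2 := by
      rw [← Finset.mul_sum, EuclideanSpace.real_norm_sq_eq]
    have hne : (Finset.univ : Finset (Fin d)).Nonempty := by
      rw [Finset.univ_nonempty_iff]
      by_contra hemp
      rw [not_nonempty_iff] at hemp
      have : ‖z‖ = 0 := by rw [norm_eq_zero]; ext i; exact hemp.elim i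
      linarith
    have h2 := Finset.sum_lt_sum_of_nonempty hne fun i _ => hcon i
    rw [h1] at h2
    simp at h2
  calc ‖z‖ ^ n ≤ ‖z‖ ^ (2 * k i) := pow_le_pow_right₀ hz (hk i)
    _ = (‖z‖ ^ 2) ^ k i := pow_mul _ _ _
    _ ≤ (d * z i ^ 2) ^ k i := by gcongr
    _ = (d : ℝ) ^ k i * z i ^ (2 * k i) := by rw [mul_pow, pow_mul]
    _ ≤ _ := Finset.single_le_sum (f := fun i => (d : ℝ) ^ k i * z i ^ (2 * k i))
        (fun j _ => mul_nonneg (by positivity) ((even_two_mul _).pow_nonneg _))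
        (Finset.mem_univ i)

/-- Higher finite moments dominate where |z| ≥ 1, the tail space where |z| < 1. -/
theorem integrable_norm_pow_mul_tailDensity (hs : 0 < s) (hp : 1 < p) (hu : MemTailSpace s p u)
    (hm : CarlemanCondition s p u) (hpos : ∀ i k, moment s p u i k ≠ 0) (n : ℕ) :
    Integrable fun y => ‖sphereInv y‖ ^ n * tailDensity s p u y := by
  choose k hkn hk using fun i => exists_moment_lt_top hm (hpos i) n
  have hbound : Integrable fun y : EuclideanSpace ℝ (Fin d) =>
      2 ^ ((d : ℝ) + s * p) * (|u y| ^ (p - 1) / (1 + ‖y‖) ^ ((d : ℝ) + s * p))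
      + ∑ i, (d : ℝ) ^ k i * (sphereInv y i ^ (2 * k i) * |tailDensity s p u y|) :=
    (hu.2.const_mul _).add (integrable_finsetSum _ fun i _ =>
      (integrable_moment_of_lt_top hp hu.1 (hk i)).const_mul _)
  refine hbound.mono' ?_ (ae_of_all _ fun y => ?_)
  · exact (measurable_sphereInv.norm.pow_const n).aestronglyMeasurable.mul
      (aestronglyMeasurable_tailDensity hu.1)
  · rw [norm_mul, norm_pow, norm_norm, Real.norm_eq_abs]
    have h1 : 0 ≤ 2 ^ ((d : ℝ) + s * p) * (|u y| ^ (p - 1) / (1 + ‖y‖) ^ ((d : ℝ) + s * p)) := by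
      positivity
    have h2 : 0 ≤ ∑ i, (d : ℝ) ^ k i * (sphereInv y i ^ (2 * k i) * |tailDensity s p u y|) :=
      Finset.sum_nonneg fun i _ => mul_nonneg (by positivity)
        (mul_nonneg ((even_two_mul _).pow_nonneg _) (abs_nonneg _))
    rcases le_or_gt 1 ‖sphereInv y‖ with hz | hz
    · have := mul_le_mul_of_nonneg_right
        (norm_pow_le_sum k (fun i => (hkn i).trans (by omega)) hz) (abs_nonneg (tailDensity s p u y))
      rw [Finset.sum_mul] at this
      simp only [mul_assoc] at this
      linarith
    -- y = 0 falls in this case because `sphereInv 0 = 0`; division by zero makes `tailDensity` zero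
    -- there.
    · rcases eq_or_ne y 0 with rfl | hy0
      · have : tailDensity s p u 0 = 0 := by
          have : (d : ℝ) + s * p ≠ 0 := by positivity
          simp [tailDensity, Real.zero_rpow this]
        rw [this] at h2 ⊢
        simp only [abs_zero, mul_zero] at h2 ⊢
        linarith
      · have hy : 1 ≤ ‖y‖ := by
          rw [norm_sphereInv] at hz
          have := norm_pos_iff.2 hy0
          exact ((inv_lt_one₀ this).1 hz).le
        have h3 := tail_bound (u := u) hs.le hp hy
        have h4 : ‖sphereInv y‖ ^ n * |tailDensity s p u y| ≤ 1 * |tailDensity s p u y| := by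
          gcongr
          exact pow_le_one₀ (norm_nonneg _) hz.le
        linarith

theorem carleman_integrals (hs : 0 < s) (hp : 1 < p) (hu : MemTailSpace s p u)
    (hm : CarlemanCondition s p u) (hpos : ∀ i k, moment s p u i k ≠ 0) (i : Fin d) :
    (∀ k : ℕ, 0 < ∫ y, sphereInv y i ^ (2 * k) * |tailDensity s p u y|) ∧
    ¬ Summable fun k : ℕ => ((∫ y, sphereInv y i ^ (2 * (k + 1)) * |tailDensity s p u y|)
      ^ (1 / (2 * ((k : ℝ) + 1))))⁻¹ := by
  have hint := integrable_norm_pow_mul_tailDensity hs hp hu hm hpos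
  have hinta : ∀ n : ℕ, Integrable fun y => ‖sphereInv y‖ ^ n * |tailDensity s p u y| := fun n => by
    simpa [abs_mul] using (hint n).abs
  have hint' : ∀ k : ℕ, Integrable fun y => sphereInv y i ^ k * |tailDensity s p u y| := fun k => by
    simpa using integrable_eval_mul measurable_sphereInv hinta (MvPolynomial.X i ^ k)
  have hnn : ∀ (k : ℕ) y, 0 ≤ sphereInv y i ^ (2 * k) * |tailDensity s p u y| := fun k y =>
    mul_nonneg ((even_two_mul k).pow_nonneg _) (abs_nonneg _)
  have e : ∀ k : ℕ, moment s p u i k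
      = ENNReal.ofReal (∫ y, sphereInv y i ^ (2 * k) * |tailDensity s p u y|) := fun k => by
    rw [moment_eq_lintegral hp, ofReal_integral_eq_lintegral_ofReal (hint' (2 * k))
      (ae_of_all _ (hnn k))]
  have hpos' : ∀ k : ℕ, 0 < ∫ y, sphereInv y i ^ (2 * k) * |tailDensity s p u y| := fun k => by
    have := hpos i k
    rw [e k] at this
    exact ENNReal.ofReal_pos.1 (pos_iff_ne_zero.2 this)
  refine ⟨hpos', fun hsum => ?_⟩
  have h := hm i
  have e2 : ∀ k : ℕ, (moment s p u i (k + 1) ^ (1 / (2 * ((k : ℝ) + 1))))⁻¹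
      = ENNReal.ofReal (((∫ y, sphereInv y i ^ (2 * (k + 1)) * |tailDensity s p u y|)
        ^ (1 / (2 * ((k : ℝ) + 1))))⁻¹) := fun k => by
    rw [e, ENNReal.ofReal_rpow_of_pos (hpos' _), ENNReal.ofReal_inv_of_pos
      (Real.rpow_pos_of_pos (hpos' _) _)]
  simp only [e2] at h
  rw [← ENNReal.ofReal_tsum_of_nonneg
    (fun k => inv_nonneg.2 (Real.rpow_nonneg (hpos' _).le _)) hsum] at h
  exact ENNReal.ofReal_ne_top h

end Density

/-! ### Symmetrised increments under the three regularity assumptions -/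

section Regularity

variable {d : ℕ} {s p : ℝ} {u : EuclideanSpace ℝ (Fin d) → ℝ} {Ω : Set (EuclideanSpace ℝ (Fin d))}

theorem MemHolderLoc.exists_abs_sub_le {β : ℝ} (h : MemHolderLoc 0 β u Ω)
    {K : Set (EuclideanSpace ℝ (Fin d))} (hK : IsCompact K) (hKΩ : K ⊆ Ω) :
    ∃ C : ℝ, 0 ≤ C ∧ ∀ x ∈ K, ∀ y ∈ K, |u x - u y| ≤ C * ‖x - y‖ ^ β := by
  obtain ⟨C, hC⟩ := h.2 K hK hKΩ
  refine ⟨max C 0, le_max_right _ _, fun x hx y hy => ?_⟩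
  have h1 := hC x hx y hy
  have h2 := ContinuousMultilinearMap.le_opNorm
    (iteratedFDeriv ℝ 0 u x - iteratedFDeriv ℝ 0 u y) ![]
  rw [sub_apply, iteratedFDeriv_zero_apply, iteratedFDeriv_zero_apply,
    Finset.univ_eq_empty, Finset.prod_empty, mul_one, Real.norm_eq_abs] at h2
  refine h2.trans (h1.trans ?_)
  gcongr
  exact le_max_left _ _

theorem MemHolderLoc.exists_norm_fderiv_sub_le {α : ℝ} (h : MemHolderLoc 1 α u Ω)
    {K : Set (EuclideanSpace ℝ (Fin d))} (hK : IsCompact K) (hKΩ : K ⊆ Ω) :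
    ∃ C : ℝ, 0 ≤ C ∧ ∀ x ∈ K, ∀ y ∈ K, ‖fderiv ℝ u x - fderiv ℝ u y‖ ≤ C * ‖x - y‖ ^ α := by
  obtain ⟨C, hC⟩ := h.2 K hK hKΩ
  refine ⟨max C 0, le_max_right _ _, fun x hx y hy => ?_⟩
  have h1 : ‖iteratedFDeriv ℝ 1 u x - iteratedFDeriv ℝ 1 u y‖ ≤ max C 0 * ‖x - y‖ ^ α := by
    refine (hC x hx y hy).trans ?_
    gcongr
    exact le_max_left _ _
  refine ContinuousLinearMap.opNorm_le_bound _ (by positivity) fun v => ?_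
  have h2 := ContinuousMultilinearMap.le_opNorm
    (iteratedFDeriv ℝ 1 u x - iteratedFDeriv ℝ 1 u y) fun _ => v
  rw [sub_apply, iteratedFDeriv_one_apply, iteratedFDeriv_one_apply] at h2
  simp only [Finset.univ_unique, Finset.prod_const, Finset.card_singleton, pow_one] at h2
  refine h2.trans ?_
  gcongr

theorem MemHolderLoc.differentiableAt {α : ℝ} (h : MemHolderLoc 1 α u Ω) (hΩ : IsOpen Ω)
    {x : EuclideanSpace ℝ (Fin d)} (hx : x ∈ Ω) : DifferentiableAt ℝ u x :=
  (h.1.differentiableOn (by simp)).differentiableAt (hΩ.mem_nhds hx)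

theorem MemHolderLoc.exists_lipschitz {α : ℝ} (h : MemHolderLoc 1 α u Ω) (hΩ : IsOpen Ω)
    (hα : 0 ≤ α) {ρ : ℝ} (hρ : 0 < ρ) (hball : Metric.closedBall 0 ρ ⊆ Ω) :
    ∃ C : ℝ, 0 ≤ C ∧ ∀ x ∈ Metric.closedBall (0 : EuclideanSpace ℝ (Fin d)) ρ,
      ∀ y ∈ Metric.closedBall (0 : EuclideanSpace ℝ (Fin d)) ρ, |u x - u y| ≤ C * ‖x - y‖ := by
  obtain ⟨C, hC, hD⟩ := h.exists_norm_fderiv_sub_le (isCompact_closedBall 0 ρ) hball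
  refine ⟨C * ρ ^ α + ‖fderiv ℝ u 0‖, by positivity, fun x hx y hy => ?_⟩
  refine (convex_closedBall 0 ρ).norm_image_sub_le_of_norm_fderiv_le (𝕜 := ℝ)
    (fun z hz => h.differentiableAt hΩ (hball hz)) (fun z hz => ?_) hy hx
  have h1 := hD z hz 0 (Metric.mem_closedBall_self hρ.le)
  rw [sub_zero] at h1
  have h2 : ‖z‖ ^ α ≤ ρ ^ α :=
    Real.rpow_le_rpow (norm_nonneg _) (mem_closedBall_zero_iff.1 hz) hα
  have h3 := norm_le_norm_sub_add (fderiv ℝ u z) (fderiv ℝ u 0)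
  have h4 : C * ‖z‖ ^ α ≤ C * ρ ^ α := by gcongr
  linarith

/-- v ↦ u(x + v) + u(x - v) has derivative Du(x + v) - Du(x - v), of norm at most C |2v|^α; the mean
value inequality gives one more power of |k|. -/
theorem MemHolderLoc.exists_second_difference_le {α : ℝ} (h : MemHolderLoc 1 α u Ω) (hΩ : IsOpen Ω)
    (hα : 0 ≤ α) {ρ : ℝ} (hball : Metric.closedBall 0 ρ ⊆ Ω) :
    ∃ C : ℝ, 0 ≤ C ∧ ∀ x k : EuclideanSpace ℝ (Fin d), ‖x‖ ≤ ρ / 2 → ‖k‖ ≤ ρ / 2 →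
      |u x - u (x + k) + (u x - u (x - k))| ≤ C * ‖k‖ ^ (1 + α) := by
  obtain ⟨C, hC, hD⟩ := h.exists_norm_fderiv_sub_le (isCompact_closedBall 0 ρ) hball
  refine ⟨C * 2 ^ α, by positivity, fun x k hx hk => ?_⟩
  have hmem : ∀ v : EuclideanSpace ℝ (Fin d), ‖v‖ ≤ ‖k‖ →
      x + v ∈ Metric.closedBall (0 : EuclideanSpace ℝ (Fin d)) ρ ∧
      x - v ∈ Metric.closedBall (0 : EuclideanSpace ℝ (Fin d)) ρ := fun v hv => by
    rw [mem_closedBall_zero_iff, mem_closedBall_zero_iff]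
    exact ⟨(norm_add_le _ _).trans (by linarith), (norm_sub_le _ _).trans (by linarith)⟩
  have key := (convex_closedBall (0 : EuclideanSpace ℝ (Fin d)) ‖k‖
    ).norm_image_sub_le_of_norm_hasFDerivWithin_le (𝕜 := ℝ)
    (f := fun v => u (x + v) + u (x - v))
    (f' := fun v => fderiv ℝ u (x + v) - fderiv ℝ u (x - v)) (C := C * (2 * ‖k‖) ^ α)
    (x := 0) (y := k) (fun v hv => ?_) (fun v hv => ?_)
    (Metric.mem_closedBall_self (norm_nonneg k)) (by simp)
  · rw [add_zero, sub_zero, sub_zero, Real.norm_eq_abs] at key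
    calc |u x - u (x + k) + (u x - u (x - k))| = |u (x + k) + u (x - k) - (u x + u x)| := by
          rw [← abs_neg]; congr 1; ring
      _ ≤ C * (2 * ‖k‖) ^ α * ‖k‖ := key
      _ = C * 2 ^ α * ‖k‖ ^ (1 + α) := by
          rw [Real.mul_rpow two_pos.le (norm_nonneg k), add_comm,
            Real.rpow_add_one' (norm_nonneg k) (by linarith)]
          ring
  · have hv' := hmem v (mem_closedBall_zero_iff.1 hv)
    have h1 := (h.differentiableAt hΩ (hball hv'.1)).hasFDerivAt
    have h2 := (h.differentiableAt hΩ (hball hv'.2)).hasFDerivAt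
    have h3 := h1.comp v ((hasFDerivAt_id v).const_add x)
    have h4 := h2.comp v ((hasFDerivAt_id v).const_sub x)
    refine ((h3.add h4).congr_fderiv ?_).hasFDerivWithinAt
    ext w
    simp [sub_eq_add_neg]
  · have hv0 := mem_closedBall_zero_iff.1 hv
    have hv' := hmem v hv0
    refine (hD _ hv'.1 _ hv'.2).trans ?_
    gcongr
    calc ‖x + v - (x - v)‖ = ‖(2 : ℝ) • v‖ := by congr 1; module
      _ = 2 * ‖v‖ := by rw [norm_smul]; norm_num
      _ ≤ 2 * ‖k‖ := by linarith

/-- The quantitative content of the regularity assumptions, on a ball around the origin. -/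
structure LocalRegularity (s p : ℝ) (u : EuclideanSpace ℝ (Fin d) → ℝ) (ρ : ℝ) : Prop where
  holder : ∃ β C : ℝ, 0 < β ∧ 0 ≤ C ∧
    ∀ x ∈ Metric.closedBall (0 : EuclideanSpace ℝ (Fin d)) ρ,
    ∀ y ∈ Metric.closedBall (0 : EuclideanSpace ℝ (Fin d)) ρ, |u x - u y| ≤ C * ‖x - y‖ ^ β
  symm : ∃ γ C : ℝ, s * p < γ ∧ 0 ≤ C ∧ ∀ x k : EuclideanSpace ℝ (Fin d), ‖x‖ ≤ ρ / 2 →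
    ‖k‖ ≤ ρ / 2 → |J p (u x - u (x + k)) + J p (u x - u (x - k))| ≤ C * ‖k‖ ^ γ

theorem add_mem_closedBall {ρ : ℝ} {x k : EuclideanSpace ℝ (Fin d)} (hx : ‖x‖ ≤ ρ / 2)
    (hk : ‖k‖ ≤ ρ / 2) : x ∈ Metric.closedBall (0 : EuclideanSpace ℝ (Fin d)) ρ ∧
      x + k ∈ Metric.closedBall (0 : EuclideanSpace ℝ (Fin d)) ρ ∧
      x - k ∈ Metric.closedBall (0 : EuclideanSpace ℝ (Fin d)) ρ := by
  simp only [mem_closedBall_zero_iff]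
  exact ⟨by linarith [norm_nonneg x], (norm_add_le _ _).trans (by linarith),
    (norm_sub_le _ _).trans (by linarith)⟩

/-- No cancellation is needed: each increment is O(|k|^(β(p-1))), and β(p - 1) > sp. -/
theorem localRegularity_of_holder {β : ℝ} (hp : 1 < p) (hs : 0 < s)
    (hβ : s * (p / (p - 1)) < β) (h : MemHolderLoc 0 β u Ω) {ρ : ℝ}
    (hball : Metric.closedBall 0 ρ ⊆ Ω) : LocalRegularity s p u ρ := by
  obtain ⟨C, hC, hu⟩ := h.exists_abs_sub_le (isCompact_closedBall 0 ρ) hball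
  have hp1 : 0 < p - 1 := by linarith
  have hβ0 : 0 < β := lt_trans (by positivity) hβ
  refine ⟨⟨β, C, hβ0, hC, hu⟩, β * (p - 1), 2 * C ^ (p - 1), ?_, by positivity,
    fun x k hx hk => ?_⟩
  · rw [← mul_div_assoc, div_lt_iff₀ hp1] at hβ
    exact hβ
  obtain ⟨m0, m1, m2⟩ := add_mem_closedBall hx hk
  have hb : ∀ y ∈ Metric.closedBall (0 : EuclideanSpace ℝ (Fin d)) ρ, ‖x - y‖ = ‖k‖ →
      |J p (u x - u y)| ≤ C ^ (p - 1) * ‖k‖ ^ (β * (p - 1)) := fun y hy hxy => by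
    rw [abs_J hp]
    calc |u x - u y| ^ (p - 1) ≤ (C * ‖x - y‖ ^ β) ^ (p - 1) :=
          Real.rpow_le_rpow (abs_nonneg _) (hu x m0 y hy) hp1.le
      _ = _ := by
          rw [hxy, Real.mul_rpow hC (by positivity), ← Real.rpow_mul (norm_nonneg k)]
  have h1 := hb _ m1 (by rw [sub_add_cancel_left, norm_neg])
  have h2 := hb _ m2 (by rw [sub_sub_cancel])
  calc _ ≤ |J p (u x - u (x + k))| + |J p (u x - u (x - k))| := abs_add_le _ _
    _ ≤ _ := by linarith

/-- J_p is odd and (p-1)-Hölder, so the sum is controlled by the second difference O(|k|^β) to the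
power p - 1. -/
theorem localRegularity_of_le_two {β : ℝ} (hp : 1 < p) (hp2 : p ≤ 2)
    (hβ : s * (p / (p - 1)) < β) (hβ1 : 1 ≤ β) (h : MemHolderLoc 1 (β - 1) u Ω) (hΩ : IsOpen Ω)
    {ρ : ℝ} (hρ : 0 < ρ) (hball : Metric.closedBall 0 ρ ⊆ Ω) : LocalRegularity s p u ρ := by
  obtain ⟨C₀, hC₀, hlip⟩ := h.exists_lipschitz hΩ (by linarith) hρ hball
  obtain ⟨C, hC, hu⟩ := h.exists_second_difference_le hΩ (by linarith) hball
  have hp1 : 0 < p - 1 := by linarith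
  refine ⟨⟨1, C₀, one_pos, hC₀, by simpa only [Real.rpow_one] using hlip⟩, β * (p - 1),
    2 * C ^ (p - 1), ?_, by positivity, fun x k hx hk => ?_⟩
  · rw [← mul_div_assoc, div_lt_iff₀ hp1] at hβ
    exact hβ
  have h1 := abs_J_sub_J_le_of_le_two hp hp2 (u x - u (x + k)) (-(u x - u (x - k)))
  rw [J_neg, sub_neg_eq_add, sub_neg_eq_add] at h1
  refine h1.trans ?_
  have h2 := hu x k hx hk
  rw [add_sub_cancel] at h2
  calc 2 * |u x - u (x + k) + (u x - u (x - k))| ^ (p - 1)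
      ≤ 2 * (C * ‖k‖ ^ β) ^ (p - 1) := by gcongr
    _ = _ := by
        rw [Real.mul_rpow hC (by positivity), ← Real.rpow_mul (norm_nonneg k), mul_assoc]

/-- Lipschitz increments to the power p - 2 times a second difference O(|k|^(1+α)); the lower bound
on α says exactly that p - 1 + α > sp. -/
theorem localRegularity_of_two_le {α : ℝ} (hp2 : 2 ≤ p) (hα : 0 ≤ α)
    (hα' : 1 - (1 - s) * p < α) (h : MemHolderLoc 1 α u Ω) (hΩ : IsOpen Ω)
    {ρ : ℝ} (hρ : 0 < ρ) (hball : Metric.closedBall 0 ρ ⊆ Ω) : LocalRegularity s p u ρ := by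
  obtain ⟨C₀, hC₀, hlip⟩ := h.exists_lipschitz hΩ hα hρ hball
  obtain ⟨C, hC, hu⟩ := h.exists_second_difference_le hΩ hα hball
  have hp1 : 0 < p - 1 := by linarith
  refine ⟨⟨1, C₀, one_pos, hC₀, by simpa only [Real.rpow_one] using hlip⟩, p - 2 + (1 + α),
    (p - 1) * (2 * C₀) ^ (p - 2) * C, by linarith, by positivity, fun x k hx hk => ?_⟩
  obtain ⟨m0, m1, m2⟩ := add_mem_closedBall hx hk
  have h1 := abs_J_sub_J_le_of_two_le hp2 (u x - u (x + k)) (-(u x - u (x - k)))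
  rw [J_neg, sub_neg_eq_add, sub_neg_eq_add, abs_neg] at h1
  refine h1.trans ?_
  have e1 := hlip x m0 _ m1
  have e2 := hlip x m0 _ m2
  rw [sub_add_cancel_left, norm_neg] at e1
  rw [sub_sub_cancel] at e2
  have h2 : (|u x - u (x + k)| + |u x - u (x - k)|) ^ (p - 2) ≤ (2 * C₀ * ‖k‖) ^ (p - 2) :=
    Real.rpow_le_rpow (by positivity) (by linarith) (by linarith)
  calc (p - 1) * (|u x - u (x + k)| + |u x - u (x - k)|) ^ (p - 2) *
        |u x - u (x + k) + (u x - u (x - k))|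
      ≤ (p - 1) * (2 * C₀ * ‖k‖) ^ (p - 2) * (C * ‖k‖ ^ (1 + α)) := by
        gcongr
        exact hu x k hx hk
    _ = _ := by
        rw [Real.mul_rpow (by positivity) (norm_nonneg k),
          Real.rpow_add_of_nonneg (y := p - 2) (z := 1 + α) (norm_nonneg k) (by linarith)
            (by linarith)]
        ring

theorem exists_localRegularity (hs : 0 < s) (hp : 1 < p) (hΩ : IsOpen Ω)
    (h0 : (0 : EuclideanSpace ℝ (Fin d)) ∈ Ω)
    (hreg :
      (2 ≤ p ∧ ∃ α : ℝ, 0 ≤ α ∧ α ≤ 1 ∧ 1 - (1 - s) * p < α ∧ MemHolderLoc 1 α u Ω) ∨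
      (∃ β : ℝ, s * (p / (p - 1)) < β ∧ β ≤ 1 ∧ MemHolderLoc 0 β u Ω) ∨
      (p ≤ 2 ∧ ∃ β : ℝ, s * (p / (p - 1)) < β ∧ β < 2 ∧
        MemHolderLoc ⌊β⌋₊ (β - ⌊β⌋₊) u Ω)) :
    ∃ ρ : ℝ, 0 < ρ ∧ ρ ≤ 1 ∧ Metric.closedBall 0 ρ ⊆ Ω ∧ LocalRegularity s p u ρ := by
  obtain ⟨ρ₀, hρ₀, hball₀⟩ := Metric.nhds_basis_closedBall.mem_iff.1 (hΩ.mem_nhds h0)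
  have hball : Metric.closedBall (0 : EuclideanSpace ℝ (Fin d)) (min ρ₀ 1) ⊆ Ω :=
    (Metric.closedBall_subset_closedBall (min_le_left _ _)).trans hball₀
  have hρ : 0 < min ρ₀ 1 := lt_min hρ₀ one_pos
  refine ⟨min ρ₀ 1, hρ, min_le_right _ _, hball, ?_⟩
  rcases hreg with ⟨hp2, α, hα, -, hα', h⟩ | ⟨β, hβ, -, h⟩ | ⟨hp2, β, hβ, hβ2, h⟩
  · exact localRegularity_of_two_le hp2 hα hα' h hΩ hρ hball
  · exact localRegularity_of_holder hp hs hβ h hball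
  · have hβ0 : 0 < β := by
      have : 0 < p - 1 := by linarith
      exact lt_trans (by positivity) hβ
    rcases lt_or_ge β 1 with hβ1 | hβ1
    · have e : ⌊β⌋₊ = 0 := Nat.floor_eq_zero.2 hβ1
      rw [e, Nat.cast_zero, sub_zero] at h
      exact localRegularity_of_holder hp hs hβ h hball
    · have e : ⌊β⌋₊ = 1 := by
        rw [Nat.floor_eq_iff hβ0.le]
        norm_num
        exact ⟨hβ1, hβ2⟩
      rw [e, Nat.cast_one] at h
      exact localRegularity_of_le_two hp hp2 hβ hβ1 h hΩ hρ hball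

theorem continuousOn_of_regularity
    (hreg :
      (2 ≤ p ∧ ∃ α : ℝ, 0 ≤ α ∧ α ≤ 1 ∧ 1 - (1 - s) * p < α ∧ MemHolderLoc 1 α u Ω) ∨
      (∃ β : ℝ, s * (p / (p - 1)) < β ∧ β ≤ 1 ∧ MemHolderLoc 0 β u Ω) ∨
      (p ≤ 2 ∧ ∃ β : ℝ, s * (p / (p - 1)) < β ∧ β < 2 ∧
        MemHolderLoc ⌊β⌋₊ (β - ⌊β⌋₊) u Ω)) : ContinuousOn u Ω := by
  rcases hreg with ⟨-, α, -, -, -, h⟩ | ⟨β, -, -, h⟩ | ⟨-, β, -, -, h⟩ <;> exact h.1.continuousOn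

end Regularity

/-! ### Infinite-order vanishing of u at the origin -/

section Flat

variable {d : ℕ} {s p : ℝ} {u : EuclideanSpace ℝ (Fin d) → ℝ}

/-- A lower bound of `|u|` on a small ball close to the origin is controlled by the moments. -/
theorem exists_mass_bound (hs : 0 < s) (hp : 1 < p)
    (hω : ∀ n : ℕ, Integrable fun y => ‖sphereInv y‖ ^ n * tailDensity s p u y) (M : ℕ) :
    ∃ K : ℝ, 0 ≤ K ∧ ∀ (x : EuclideanSpace ℝ (Fin d)) (b r : ℝ), x ≠ 0 → ‖x‖ ≤ 1 / 2 → 0 ≤ b →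
      0 ≤ r → r ≤ ‖x‖ → (∀ y ∈ Metric.ball x r, b ≤ |u y|) →
      b ^ (p - 1) * r ^ d ≤ K * ‖x‖ ^ M := by
  set I := ∫ y, ‖sphereInv y‖ ^ M * |tailDensity s p u y|
  have hint : Integrable fun y => ‖sphereInv y‖ ^ M * |tailDensity s p u y| := by
    simpa [abs_mul] using (hω M).abs
  have hI : 0 ≤ I := integral_nonneg fun y => by positivity
  set c := (volume : Measure (EuclideanSpace ℝ (Fin d))).real (Metric.ball 0 1)
  have hc : 0 < c := ENNReal.toReal_pos (Metric.measure_ball_pos _ _ one_pos).ne'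
    measure_ball_lt_top.ne
  refine ⟨2 ^ M * I / c, by positivity, fun x b r hx hx2 hb hr hrx hu => ?_⟩
  have hx0 := norm_pos_iff.2 hx
  have : Nontrivial (EuclideanSpace ℝ (Fin d)) := ⟨x, 0, hx⟩
  have hvol : (volume : Measure (EuclideanSpace ℝ (Fin d))).real (Metric.ball x r) = r ^ d * c := by
    rw [measureReal_def, Measure.addHaar_ball _ _ hr, ENNReal.toReal_mul,
      ENNReal.toReal_ofReal (by positivity), finrank_euclideanSpace_fin]
    rfl
  have h1 : b ^ (p - 1) / (2 * ‖x‖) ^ M * volume.real (Metric.ball x r)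
      ≤ ∫ y in Metric.ball x r, ‖sphereInv y‖ ^ M * |tailDensity s p u y| := by
    refine setIntegral_ge_of_const_le_real measurableSet_ball measure_ball_lt_top.ne
      (fun y hy => ?_) hint.integrableOn
    have hxy : ‖x - y‖ < r := by rwa [mem_ball_iff_norm'] at hy
    have hy0 : 0 < ‖y‖ := by
      have := norm_le_norm_add_norm_sub y x
      rw [norm_sub_rev] at this
      linarith
    have hy2 : ‖y‖ ≤ 2 * ‖x‖ := by
      have := norm_le_norm_add_norm_sub x y
      linarith
    rw [abs_tailDensity hp, norm_sphereInv, inv_pow, inv_mul_eq_div, div_right_comm]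
    -- |y| ≤ 2|x| ≤ 1, so the factor |y|^(-κ) ≥ 1 can be dropped.
    have h2 : |u y| ^ (p - 1) ≤ |u y| ^ (p - 1) / ‖y‖ ^ ((d : ℝ) + s * p) := by
      rw [le_div_iff₀ (Real.rpow_pos_of_pos hy0 _)]
      exact mul_le_of_le_one_right (by positivity)
        (Real.rpow_le_one hy0.le (by linarith) (by positivity))
    have h3 : b ^ (p - 1) ≤ |u y| ^ (p - 1) := Real.rpow_le_rpow hb (hu y hy) (by linarith)
    calc b ^ (p - 1) / (2 * ‖x‖) ^ M ≤ |u y| ^ (p - 1) / ‖y‖ ^ M := by gcongr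
      _ ≤ |u y| ^ (p - 1) / ‖y‖ ^ ((d : ℝ) + s * p) / ‖y‖ ^ M := by gcongr
      _ = _ := div_right_comm _ _ _
  have h2 : ∫ y in Metric.ball x r, ‖sphereInv y‖ ^ M * |tailDensity s p u y| ≤ I :=
    setIntegral_le_integral hint (ae_of_all _ fun y => by positivity)
  have h3 := h1.trans h2
  rw [hvol, div_mul_eq_mul_div, div_le_iff₀ (by positivity)] at h3
  rw [div_mul_eq_mul_div, le_div_iff₀ hc]
  calc b ^ (p - 1) * r ^ d * c = b ^ (p - 1) * (r ^ d * c) := by ring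
    _ ≤ I * (2 * ‖x‖) ^ M := h3
    _ = _ := by rw [mul_pow]; ring

/-- A Hölder continuous function with finite moments vanishes to infinite order at the origin. -/
theorem exists_flat (hs : 0 < s) (hp : 1 < p) {ρ : ℝ} (hρ : 0 < ρ) (hρ1 : ρ ≤ 1)
    (hreg : LocalRegularity s p u ρ)
    (hω : ∀ n : ℕ, Integrable fun y => ‖sphereInv y‖ ^ n * tailDensity s p u y) :
    ∃ ρ' : ℝ, 0 < ρ' ∧ ρ' ≤ ρ / 2 ∧ ∀ N : ℕ, ∃ C : ℝ, 0 ≤ C ∧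
      ∀ x : EuclideanSpace ℝ (Fin d), x ≠ 0 → ‖x‖ < ρ' → |u x| ≤ C * ‖x‖ ^ N := by
  obtain ⟨β, C₁, hβ, hC₁, hu⟩ := hreg.holder
  set C₀ := max 1 C₁
  have hC₀ : 1 ≤ C₀ := le_max_left _ _
  -- On a ball of radius b^k the oscillation of u is at most C₁ b^(kβ) ≤ C₀ b ≤ |u x| / 2; the mass
  -- bound then involves b^(p-1) (b^k)^d = b^e.
  set k := ⌈1 / β⌉₊
  have hkβ : 1 ≤ k * β := by
    have := Nat.le_ceil (1 / β)
    rwa [div_le_iff₀ hβ] at this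
  have hk : k ≠ 0 := (Nat.ceil_pos.2 (by positivity)).ne'
  set e : ℝ := p - 1 + k * d
  have he : 0 < e := by
    have : (0 : ℝ) ≤ k * d := by positivity
    simp only [e]; linarith
  -- The minimum with ‖x‖ ensures b^k ≤ ‖x‖, as the mass bound requires.
  have key : ∀ N : ℕ, ∃ K : ℝ, 0 ≤ K ∧ ∀ x : EuclideanSpace ℝ (Fin d), x ≠ 0 → ‖x‖ ≤ ρ / 2 →
      min ‖x‖ (|u x| / (2 * C₀)) ≤ K * ‖x‖ ^ N := by
    intro N
    obtain ⟨K, hK, hmass⟩ := exists_mass_bound hs hp hω ⌈N * e⌉₊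
    refine ⟨K ^ e⁻¹, by positivity, fun x hx hxρ => ?_⟩
    have hx0 := norm_pos_iff.2 hx
    set b := min ‖x‖ (|u x| / (2 * C₀))
    have hb0 : 0 ≤ b := le_min hx0.le (by positivity)
    have hbx : b ≤ ‖x‖ := min_le_left _ _
    have hb1 : b ≤ 1 := by linarith
    have hba : C₀ * b ≤ |u x| / 2 := by
      have : b ≤ |u x| / (2 * C₀) := min_le_right _ _
      rw [le_div_iff₀ (by positivity)] at this
      linarith
    have hrb : b ^ k ≤ b := pow_le_of_le_one hb0 hb1 hk
    have h1 := hmass x b (b ^ k) hx (by linarith) hb0 (by positivity) (hrb.trans hbx) (by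
      intro y hy
      have hxy : ‖x - y‖ < b ^ k := by rwa [mem_ball_iff_norm'] at hy
      have hy2 : ‖y‖ ≤ ρ := by
        have := norm_le_norm_add_norm_sub x y
        linarith
      have h2 := hu x (mem_closedBall_zero_iff.2 (by linarith)) y (mem_closedBall_zero_iff.2 hy2)
      have h3 : C₁ * ‖x - y‖ ^ β ≤ C₀ * b := by
        have h4 : ‖x - y‖ ^ β ≤ b := by
          calc ‖x - y‖ ^ β ≤ (b ^ k) ^ β := Real.rpow_le_rpow (norm_nonneg _) hxy.le hβ.le
            _ = b ^ (k * β) := by rw [← Real.rpow_natCast, ← Real.rpow_mul hb0]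
            _ ≤ b ^ (1 : ℝ) := by
                rcases hb0.eq_or_lt with h | h
                · rw [← h, Real.zero_rpow (by positivity), Real.zero_rpow one_ne_zero]
                · exact Real.rpow_le_rpow_of_exponent_ge h hb1 hkβ
            _ = b := Real.rpow_one b
        exact mul_le_mul (le_max_right _ _) h4 (by positivity) (by positivity)
      have h5 := abs_sub_abs_le_abs_sub (u x) (u y)
      have h6 : b ≤ C₀ * b := le_mul_of_one_le_left hb0 hC₀
      linarith)
    have h2 : b ^ e ≤ K * (‖x‖ ^ N) ^ e := by
      have e1 : b ^ (p - 1) * (b ^ k) ^ d = b ^ e := by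
        rw [← pow_mul, ← Real.rpow_natCast, ← Real.rpow_add_of_nonneg hb0 (by linarith)
          (by positivity)]
        push_cast
        rfl
      have e2 : ‖x‖ ^ ⌈N * e⌉₊ ≤ (‖x‖ ^ N) ^ e := by
        rw [← Real.rpow_natCast, ← Real.rpow_natCast, ← Real.rpow_mul hx0.le]
        exact Real.rpow_le_rpow_of_exponent_ge hx0 (by linarith) (Nat.le_ceil _)
      rw [← e1]
      exact h1.trans (by gcongr)
    have h3 := Real.rpow_le_rpow (by positivity) h2 (inv_pos.2 he).le
    rwa [Real.rpow_rpow_inv hb0 he.ne', Real.mul_rpow hK (by positivity),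
      Real.rpow_rpow_inv (by positivity) he.ne'] at h3
  -- Order 2 rules out that the minimum is ‖x‖: the inequality ‖x‖ ≤ K₂ ‖x‖² fails for 0 < ‖x‖ <
  -- 1/(K₂ + 1).
  obtain ⟨K₂, hK₂, h2⟩ := key 2
  refine ⟨min (ρ / 2) (1 / (K₂ + 1)), by positivity, min_le_left _ _, fun N => ?_⟩
  obtain ⟨K, hK, hN⟩ := key N
  refine ⟨2 * C₀ * K, by positivity, fun x hx hxρ => ?_⟩
  have hx0 := norm_pos_iff.2 hx
  have hx1 : ‖x‖ ≤ ρ / 2 := hxρ.le.trans (min_le_left _ _)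
  have hx2 : ‖x‖ < 1 / (K₂ + 1) := hxρ.trans_le (min_le_right _ _)
  rw [lt_div_iff₀ (by positivity)] at hx2
  have h3 := h2 x hx hx1
  have h4 := hN x hx hx1
  rcases le_total ‖x‖ (|u x| / (2 * C₀)) with h | h
  · rw [min_eq_left h] at h3
    nlinarith
  · rw [min_eq_right h, div_le_iff₀ (by positivity)] at h4
    linarith

end Flat

/-! ### The principal value near x -/

section NearPart

variable {d : ℕ} {s p : ℝ} {u : EuclideanSpace ℝ (Fin d) → ℝ}

/-- An integral over an annulus is controlled by the even part of the integrand. -/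
theorem abs_setIntegral_annulus_le {F B : EuclideanSpace ℝ (Fin d) → ℝ}
    {x : EuclideanSpace ℝ (Fin d)} {ε R : ℝ} (hR : R ≤ 1)
    (hF : IntegrableOn F (Metric.ball x R \ Metric.ball x ε)) (hB0 : ∀ k, 0 ≤ B k)
    (hB : IntegrableOn B (Metric.ball 0 1))
    (hFB : ∀ k, ε ≤ ‖k‖ → ‖k‖ < R → |F (x + k) + F (x - k)| ≤ B k) :
    |∫ y in Metric.ball x R \ Metric.ball x ε, F y| ≤ ∫ k in Metric.ball 0 1, B k := by
  set A := Metric.ball x R \ Metric.ball x ε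
  have hA : MeasurableSet A := measurableSet_ball.diff measurableSet_ball
  set G := A.indicator F
  have hG : Integrable G := hF.integrable_indicator hA
  have hG1 : Integrable fun k => G (x + k) := hG.comp_add_left x
  have hG2 : Integrable fun k => G (x - k) := hG.comp_sub_left x
  have e : 2 * ∫ y in A, F y = ∫ k, (G (x + k) + G (x - k)) := by
    rw [integral_add hG1 hG2, integral_add_left_eq_self, integral_sub_left_eq_self,
      integral_indicator hA]
    ring
  have hmem : ∀ k, ((x + k ∈ A) ↔ (ε ≤ ‖k‖ ∧ ‖k‖ < R)) ∧ ((x - k ∈ A) ↔ (ε ≤ ‖k‖ ∧ ‖k‖ < R)) := by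
    intro k
    simp only [A, Set.mem_sdiff, mem_ball_iff_norm, add_sub_cancel_left, sub_sub_cancel_left,
      norm_neg, not_lt]
    tauto
  have h : |∫ k, (G (x + k) + G (x - k))| ≤ ∫ k, (Metric.ball 0 1).indicator B k := by
    rw [← Real.norm_eq_abs]
    refine norm_integral_le_of_norm_le (hB.integrable_indicator measurableSet_ball)
      (ae_of_all _ fun k => ?_)
    rw [Real.norm_eq_abs]
    change |A.indicator F (x + k) + A.indicator F (x - k)| ≤ _
    by_cases hk : ε ≤ ‖k‖ ∧ ‖k‖ < R
    · rw [Set.indicator_of_mem ((hmem k).1.2 hk), Set.indicator_of_mem ((hmem k).2.2 hk),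
        Set.indicator_of_mem (mem_ball_zero_iff.2 (hk.2.trans_le hR))]
      exact hFB k hk.1 hk.2
    · rw [Set.indicator_of_notMem (fun h => hk ((hmem k).1.1 h)),
        Set.indicator_of_notMem (fun h => hk ((hmem k).2.1 h)), add_zero, abs_zero]
      exact Set.indicator_nonneg (fun k _ => hB0 k) k
  rw [integral_indicator measurableSet_ball, ← e, abs_mul, abs_two] at h
  have := abs_nonneg (∫ y in A, F y)
  linarith

/-- Interpolation between the regularity and the flatness of `u`. -/
theorem exists_symm_increment_le (hs : 0 < s) (hp : 1 < p) {ρ ρ' : ℝ} (hρ : ρ ≤ 1)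
    (hρ' : ρ' ≤ ρ / 2) (hreg : LocalRegularity s p u ρ)
    (hflat : ∀ N : ℕ, ∃ C : ℝ, 0 ≤ C ∧
      ∀ x : EuclideanSpace ℝ (Fin d), x ≠ 0 → ‖x‖ < ρ' → |u x| ≤ C * ‖x‖ ^ N) :
    ∃ γ : ℝ, s * p < γ ∧ ∀ N : ℕ, ∃ D : ℝ, 0 ≤ D ∧ ∀ x k : EuclideanSpace ℝ (Fin d), x ≠ 0 →
      ‖x‖ < ρ' / 2 → ‖k‖ < ‖x‖ / 2 →
      |J p (u x - u (x + k)) + J p (u x - u (x - k))| ≤ D * ‖x‖ ^ N * ‖k‖ ^ γ := by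
  obtain ⟨γ, C₁, hγ, hC₁, hsymm⟩ := hreg.symm
  have hsp : 0 < s * p := by positivity
  have hγ0 : 0 < γ := hsp.trans hγ
  have hp1 : 0 < p - 1 := by linarith
  -- The midpoint stays above sp and leaves the share 1 - η of the estimate to flatness.
  set γ' := (γ + s * p) / 2
  set η := γ' / γ
  have hη0 : 0 < η := by positivity
  have hη1 : 0 < 1 - η := by
    rw [sub_pos, div_lt_one hγ0]
    simp only [γ']; linarith
  refine ⟨γ', by simp only [γ']; linarith, fun N => ?_⟩
  set M := ⌈(N : ℝ) / ((p - 1) * (1 - η))⌉₊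
  have hM : (N : ℝ) ≤ M * (p - 1) * (1 - η) := by
    have := Nat.le_ceil ((N : ℝ) / ((p - 1) * (1 - η)))
    rwa [div_le_iff₀ (by positivity), ← mul_assoc] at this
  obtain ⟨C, hC, hu⟩ := hflat M
  set E := 2 * (2 * C * 2 ^ M) ^ (p - 1)
  have hE : 0 ≤ E := by positivity
  refine ⟨C₁ ^ η * E ^ (1 - η), by positivity, fun x k hx hxρ hk => ?_⟩
  have hx0 := norm_pos_iff.2 hx
  have hxu := hu x hx (by linarith)
  set A := |J p (u x - u (x + k)) + J p (u x - u (x - k))|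
  have hA0 : 0 ≤ A := abs_nonneg _
  have hA1 : A ≤ C₁ * ‖k‖ ^ γ := hsymm x k (by linarith) (by linarith)
  have hJ : ∀ y : EuclideanSpace ℝ (Fin d), ‖x - y‖ = ‖k‖ →
      |J p (u x - u y)| ≤ (2 * C * 2 ^ M) ^ (p - 1) * (‖x‖ ^ M) ^ (p - 1) := by
    intro y hy
    have hy2 : ‖y‖ ≤ 2 * ‖x‖ := by
      have := norm_le_norm_add_norm_sub x y
      linarith
    have hy0 : y ≠ 0 := by
      rintro rfl
      rw [sub_zero] at hy
      linarith
    have hyu := hu y hy0 (by linarith)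
    have h1 : C * ‖y‖ ^ M ≤ C * (2 ^ M * ‖x‖ ^ M) := by
      rw [← mul_pow]; gcongr
    have h2 : C * ‖x‖ ^ M ≤ C * (2 ^ M * ‖x‖ ^ M) := by
      rw [← mul_pow]; gcongr; linarith
    rw [abs_J hp, ← Real.mul_rpow (by positivity) (by positivity)]
    refine Real.rpow_le_rpow (abs_nonneg _) ?_ hp1.le
    have := abs_sub (u x) (u y)
    linarith
  have hA2 : A ≤ E * ‖x‖ ^ (M * (p - 1)) := by
    have h1 := hJ (x + k) (by rw [sub_add_cancel_left, norm_neg])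
    have h2 := hJ (x - k) (by rw [sub_sub_cancel])
    have h3 : (‖x‖ ^ M) ^ (p - 1) = ‖x‖ ^ (M * (p - 1)) := by
      rw [← Real.rpow_natCast, ← Real.rpow_mul hx0.le]
    rw [← h3]
    calc A ≤ |J p (u x - u (x + k))| + |J p (u x - u (x - k))| := abs_add_le _ _
      _ ≤ _ := by simp only [E]; linarith
  have hsplit : A = A ^ η * A ^ (1 - η) := by
    rw [← Real.rpow_add_of_nonneg hA0 hη0.le hη1.le, add_sub_cancel, Real.rpow_one]
  have h1 : A ^ η ≤ C₁ ^ η * ‖k‖ ^ γ' := by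
    refine (Real.rpow_le_rpow hA0 hA1 hη0.le).trans_eq ?_
    rw [Real.mul_rpow hC₁ (by positivity), ← Real.rpow_mul (norm_nonneg k),
      mul_div_cancel₀ _ hγ0.ne']
  have h2 : A ^ (1 - η) ≤ E ^ (1 - η) * ‖x‖ ^ N := by
    refine (Real.rpow_le_rpow hA0 hA2 hη1.le).trans ?_
    rw [Real.mul_rpow hE (by positivity), ← Real.rpow_mul hx0.le, ← Real.rpow_natCast]
    gcongr ?_ * ?_
    exact Real.rpow_le_rpow_of_exponent_ge hx0 (by linarith) hM
  rw [hsplit]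
  calc A ^ η * A ^ (1 - η) ≤ (C₁ ^ η * ‖k‖ ^ γ') * (E ^ (1 - η) * ‖x‖ ^ N) := by gcongr
    _ = _ := by ring

/-- The exponent γ > sp makes |k|^(γ-κ) integrable at 0, so the symmetrised annulus integrals are
bounded uniformly in ε. -/
theorem exists_near_part_le (hd : 0 < d) (hs : 0 < s) (hp : 1 < p) {ρ ρ' : ℝ} (hρ : ρ ≤ 1)
    (hρ' : ρ' ≤ ρ / 2) (hreg : LocalRegularity s p u ρ)
    (hflat : ∀ N : ℕ, ∃ C : ℝ, 0 ≤ C ∧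
      ∀ x : EuclideanSpace ℝ (Fin d), x ≠ 0 → ‖x‖ < ρ' → |u x| ≤ C * ‖x‖ ^ N) (N : ℕ) :
    ∃ C : ℝ, 0 ≤ C ∧ ∀ x : EuclideanSpace ℝ (Fin d), x ≠ 0 → ‖x‖ < ρ' / 2 → ∀ L : ℝ,
      HasFracPLaplacianAt s p u x L →
      |L - ∫ y in (Metric.ball x (‖x‖ / 2))ᶜ, kernelIntegrand s p u x y| ≤ C * ‖x‖ ^ N := by
  obtain ⟨γ, hγ, hD⟩ := exists_symm_increment_le hs hp hρ hρ' hreg hflat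
  obtain ⟨D, hD0, hD⟩ := hD N
  set κ := (d : ℝ) + s * p
  have hint : IntegrableOn (fun k : EuclideanSpace ℝ (Fin d) => ‖k‖ ^ (γ - κ))
      (Metric.ball 0 1) := by
    refine integrableOn_ball_of_norm_le_rpow (C := 1) (α := κ - γ) ?_ ?_ ?_
      (Measurable.aestronglyMeasurable (by fun_prop))
    · rw [finrank_euclideanSpace_fin]; exact hd
    · rw [finrank_euclideanSpace_fin]; simp only [κ]; linarith
    · refine ae_of_all _ fun k => ?_
      rw [neg_sub, one_mul, Real.norm_eq_abs, abs_of_nonneg (by positivity)]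
  set I := ∫ k : EuclideanSpace ℝ (Fin d) in Metric.ball 0 1, ‖k‖ ^ (γ - κ)
  have hI : 0 ≤ I := integral_nonneg fun k => by positivity
  refine ⟨D * I, by positivity, fun x hx hxρ L hL => ?_⟩
  have hx0 := norm_pos_iff.2 hx
  set R := ‖x‖ / 2
  have hR : 0 < R := by positivity
  refine le_of_tendsto ((hL.2.sub_const _).abs) ?_
  filter_upwards [Ioo_mem_nhdsGT hR] with ε hε
  have hsub : Metric.ball x ε ⊆ Metric.ball x R := Metric.ball_subset_ball hε.2.le
  have hann : Metric.ball x R \ Metric.ball x ε ⊆ (Metric.ball x ε)ᶜ := fun y hy => hy.2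
  have hunion : (Metric.ball x ε)ᶜ
      = (Metric.ball x R \ Metric.ball x ε) ∪ (Metric.ball x R)ᶜ := by
    ext y
    have := @hsub y
    simp only [Set.mem_compl_iff, Set.mem_union, Set.mem_sdiff]
    tauto
  have hdisj : Disjoint (Metric.ball x R \ Metric.ball x ε) (Metric.ball x R)ᶜ :=
    Set.disjoint_left.2 fun y hy h => h hy.1
  rw [hunion, setIntegral_union hdisj measurableSet_ball.compl ((hL.1 ε hε.1).mono_set hann)
    (hL.1 R hR), add_sub_cancel_right]
  refine (abs_setIntegral_annulus_le (B := fun k => D * ‖x‖ ^ N * ‖k‖ ^ (γ - κ))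
    (by simp only [R]; linarith) ((hL.1 ε hε.1).mono_set hann) (fun k => by positivity)
    (hint.const_mul _) fun k hk1 hk2 => ?_).trans_eq ?_
  · have hk0 : 0 < ‖k‖ := hε.1.trans_le hk1
    have h1 := hD x k hx hxρ hk2
    rw [kernelIntegrand, kernelIntegrand, sub_add_cancel_left, sub_sub_cancel, norm_neg,
      ← add_div, abs_div, abs_of_nonneg (Real.rpow_nonneg hk0.le _), Real.rpow_sub hk0,
      ← mul_div_assoc]
    gcongr
  · rw [integral_const_mul]
    ring

end NearPart

/-! ### The integral away from x and its expansion -/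

section FarPart

variable {d : ℕ} {s p : ℝ} {u : EuclideanSpace ℝ (Fin d) → ℝ}

theorem inv_rpow_norm_sub_le {κ : ℝ} (hκ : 0 ≤ κ) {x y : EuclideanSpace ℝ (Fin d)} (hx : x ≠ 0)
    (hx1 : ‖x‖ ≤ 1) (hxy : ‖x‖ / 2 ≤ ‖x - y‖) :
    (‖x - y‖ ^ κ)⁻¹ ≤ 5 ^ κ * (‖x‖ ^ κ)⁻¹ * ((1 + ‖y‖) ^ κ)⁻¹ := by
  have hx0 := norm_pos_iff.2 hx
  have hxy0 : 0 < ‖x - y‖ := by linarith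
  -- |x| ≤ 2|x - y|, and |x||y| ≤ |x| + |x - y| ≤ 3|x - y| since |x| ≤ 1.
  have h1 : ‖x‖ * (1 + ‖y‖) ≤ 5 * ‖x - y‖ := by
    have := norm_le_norm_add_norm_sub x y
    nlinarith
  have h2 : ‖x‖ ^ κ * (1 + ‖y‖) ^ κ ≤ 5 ^ κ * ‖x - y‖ ^ κ := by
    rw [← Real.mul_rpow hx0.le (by positivity), ← Real.mul_rpow (by norm_num) hxy0.le]
    exact Real.rpow_le_rpow (by positivity) h1 hκ
  rw [mul_assoc, ← mul_inv, ← div_eq_mul_inv, inv_eq_one_div,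
    div_le_div_iff₀ (by positivity) (by positivity)]
  linarith

theorem integrable_far_majorant (hs : 0 < s) (hp : 1 < p) (hu : MemTailSpace s p u) :
    Integrable fun y : EuclideanSpace ℝ (Fin d) =>
      (1 + |u y| ^ (p - 1)) * ((1 + ‖y‖) ^ ((d : ℝ) + s * p))⁻¹ := by
  have h1 : Integrable fun y : EuclideanSpace ℝ (Fin d) =>
      (1 + ‖y‖) ^ (-((d : ℝ) + s * p)) := by
    refine integrable_one_add_norm ?_
    rw [finrank_euclideanSpace_fin]
    have : 0 < s * p := by positivity
    linarith
  refine (h1.add hu.2).congr (ae_of_all _ fun y => ?_)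
  simp only [Pi.add_apply]
  rw [Real.rpow_neg (by positivity)]
  ring

theorem integrableOn_far (hs : 0 < s) (hp : 1 < p) (hu : MemTailSpace s p u)
    {x : EuclideanSpace ℝ (Fin d)} (hx : x ≠ 0) (hx1 : ‖x‖ ≤ 1) :
    IntegrableOn (fun y => J p (u y) * (‖x - y‖ ^ ((d : ℝ) + s * p))⁻¹)
      (Metric.ball x (‖x‖ / 2))ᶜ := by
  refine (((integrable_far_majorant hs hp hu).const_mul
    (5 ^ ((d : ℝ) + s * p) * (‖x‖ ^ ((d : ℝ) + s * p))⁻¹)).integrableOn).mono' ?_ ?_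
  · refine AEStronglyMeasurable.restrict ((aestronglyMeasurable_J_comp hu.1).mul ?_)
    exact (by fun_prop : Measurable fun y : EuclideanSpace ℝ (Fin d) =>
      (‖x - y‖ ^ ((d : ℝ) + s * p))⁻¹).aestronglyMeasurable
  · refine (ae_restrict_iff' measurableSet_ball.compl).2 (ae_of_all _ fun y hy => ?_)
    have hxy : ‖x‖ / 2 ≤ ‖x - y‖ := by
      rw [Set.mem_compl_iff, mem_ball_iff_norm', not_lt] at hy
      exact hy
    have h1 := inv_rpow_norm_sub_le (κ := (d : ℝ) + s * p) (by positivity) hx hx1 hxy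
    rw [norm_mul, Real.norm_eq_abs, abs_J hp, Real.norm_eq_abs,
      abs_of_nonneg (by positivity : 0 ≤ (‖x - y‖ ^ ((d : ℝ) + s * p))⁻¹)]
    calc |u y| ^ (p - 1) * (‖x - y‖ ^ ((d : ℝ) + s * p))⁻¹
        ≤ (1 + |u y| ^ (p - 1)) *
          (5 ^ ((d : ℝ) + s * p) * (‖x‖ ^ ((d : ℝ) + s * p))⁻¹
            * ((1 + ‖y‖) ^ ((d : ℝ) + s * p))⁻¹) := by
          gcongr
          linarith
      _ = _ := by ring

/-- Dropping u(x) costs |u(x)|^θ, and the kernel bound costs |x|^(-κ); flatness of order M with Mθ ≥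
N + κ pays for both. -/
theorem exists_far_part_le (hs : 0 < s) (hp : 1 < p) (hu : MemTailSpace s p u) {ρ' : ℝ}
    (hρ0 : 0 < ρ') (hρ' : ρ' ≤ 1)
    (hflat : ∀ N : ℕ, ∃ C : ℝ, 0 ≤ C ∧
      ∀ x : EuclideanSpace ℝ (Fin d), x ≠ 0 → ‖x‖ < ρ' → |u x| ≤ C * ‖x‖ ^ N) (N : ℕ) :
    ∃ C ρ : ℝ, 0 ≤ C ∧ 0 < ρ ∧ ∀ x : EuclideanSpace ℝ (Fin d), x ≠ 0 → ‖x‖ < ρ →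
      IntegrableOn (kernelIntegrand s p u x) (Metric.ball x (‖x‖ / 2))ᶜ →
      |(∫ y in (Metric.ball x (‖x‖ / 2))ᶜ, kernelIntegrand s p u x y)
        + ∫ y in (Metric.ball x (‖x‖ / 2))ᶜ, J p (u y) * (‖x - y‖ ^ ((d : ℝ) + s * p))⁻¹|
        ≤ C * ‖x‖ ^ N := by
  set κ := (d : ℝ) + s * p
  have hκ : 0 ≤ κ := by positivity
  obtain ⟨C₀, θ, hC₀, hθ, hJ⟩ := exists_abs_J_sub_add_J_le hp
  obtain ⟨C₁, hC₁, hu1⟩ := hflat 1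
  set M := ⌈((N : ℝ) + κ) / θ⌉₊
  have hM : (N : ℝ) + κ ≤ M * θ := by
    have := Nat.le_ceil (((N : ℝ) + κ) / θ)
    rwa [div_le_iff₀ hθ] at this
  obtain ⟨C₂, hC₂, hu2⟩ := hflat M
  set W : EuclideanSpace ℝ (Fin d) → ℝ := fun y => (1 + |u y| ^ (p - 1)) * ((1 + ‖y‖) ^ κ)⁻¹
  have hW : Integrable W := integrable_far_majorant hs hp hu
  have hW0 : ∀ y, 0 ≤ W y := fun y => by positivity
  set I := ∫ y, W y
  have hI : 0 ≤ I := integral_nonneg hW0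
  refine ⟨C₀ * C₂ ^ θ * 5 ^ κ * I, min ρ' (1 / (C₁ + 1)), by positivity, by positivity,
    fun x hx hxρ hk => ?_⟩
  have hx0 := norm_pos_iff.2 hx
  have hxρ' : ‖x‖ < ρ' := hxρ.trans_le (min_le_left _ _)
  have hx1 : ‖x‖ ≤ 1 := by linarith
  have hux : |u x| ≤ 1 := by
    have h1 := hu1 x hx hxρ'
    have h2 : ‖x‖ < 1 / (C₁ + 1) := hxρ.trans_le (min_le_right _ _)
    rw [lt_div_iff₀ (by positivity)] at h2
    rw [pow_one] at h1
    nlinarith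
  have hsmall : |u x| ^ θ * (‖x‖ ^ κ)⁻¹ ≤ C₂ ^ θ * ‖x‖ ^ N := by
    have h1 : |u x| ^ θ ≤ C₂ ^ θ * ‖x‖ ^ (M * θ) := by
      refine (Real.rpow_le_rpow (abs_nonneg _) (hu2 x hx hxρ') hθ.le).trans_eq ?_
      rw [Real.mul_rpow hC₂ (by positivity), ← Real.rpow_natCast, ← Real.rpow_mul hx0.le]
    have h2 : ‖x‖ ^ (M * θ) ≤ ‖x‖ ^ N * ‖x‖ ^ κ := by
      rw [← Real.rpow_natCast, ← Real.rpow_add hx0]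
      exact Real.rpow_le_rpow_of_exponent_ge hx0 hx1 hM
    rw [← div_eq_mul_inv, div_le_iff₀ (by positivity), mul_assoc]
    exact h1.trans (by gcongr)
  rw [← integral_add hk (integrableOn_far hs hp hu hx hx1)]
  have hc0 : 0 ≤ C₀ * C₂ ^ θ * 5 ^ κ * ‖x‖ ^ N := by positivity
  calc _ ≤ ∫ y in (Metric.ball x (‖x‖ / 2))ᶜ, C₀ * C₂ ^ θ * 5 ^ κ * ‖x‖ ^ N * W y := by
        rw [← Real.norm_eq_abs]
        refine norm_integral_le_of_norm_le (hW.const_mul _).integrableOn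
          ((ae_restrict_iff' measurableSet_ball.compl).2 (ae_of_all _ fun y hy => ?_))
        have hxy : ‖x‖ / 2 ≤ ‖x - y‖ := by
          rw [Set.mem_compl_iff, mem_ball_iff_norm', not_lt] at hy
          exact hy
        have h1 := inv_rpow_norm_sub_le hκ hx hx1 hxy
        have h2 := hJ (u x) (u y) hux
        rw [kernelIntegrand, div_eq_mul_inv, ← add_mul, norm_mul, Real.norm_eq_abs,
          Real.norm_eq_abs, abs_of_nonneg (by positivity : 0 ≤ (‖x - y‖ ^ κ)⁻¹)]
        calc _ ≤ (C₀ * |u x| ^ θ * (1 + |u y| ^ (p - 1))) *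
              (5 ^ κ * (‖x‖ ^ κ)⁻¹ * ((1 + ‖y‖) ^ κ)⁻¹) := by gcongr
          _ = C₀ * 5 ^ κ * W y * (|u x| ^ θ * (‖x‖ ^ κ)⁻¹) := by simp only [W]; ring
          _ ≤ C₀ * 5 ^ κ * W y * (C₂ ^ θ * ‖x‖ ^ N) := by
              have := hW0 y
              gcongr
          _ = _ := by ring
    _ ≤ ∫ y, C₀ * C₂ ^ θ * 5 ^ κ * ‖x‖ ^ N * W y :=
        setIntegral_le_integral (hW.const_mul _) (ae_of_all _ fun y => mul_nonneg hc0 (hW0 y))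
    _ = _ := by rw [integral_const_mul]; ring

theorem integrable_eval_tau_mul {z : EuclideanSpace ℝ (Fin d) → EuclideanSpace ℝ (Fin d)}
    (hz : Measurable z) {ω : EuclideanSpace ℝ (Fin d) → ℝ}
    (hω : ∀ n : ℕ, Integrable fun y => ‖z y‖ ^ n * ω y) (P : Polynomial ℝ)
    (x : EuclideanSpace ℝ (Fin d)) : Integrable fun y => P.eval (tau x (z y)) * ω y := by
  simpa only [eval_eval_tauEval] using integrable_eval_mul hz hω
    (MvPolynomial.eval (fun i => MvPolynomial.C (x i)) (tauEval d P))

/-- Outside B(x, |x|/2) the kernel remainder is integrated; inside, only the Taylor polynomial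
contributes, and it is small by itself. -/
theorem exists_expansion_le (hd : 0 < d) (hs : 0 < s) (hp : 1 < p) (hu : MemTailSpace s p u)
    (hω : ∀ n : ℕ, Integrable fun y => ‖sphereInv y‖ ^ n * tailDensity s p u y) (N : ℕ) :
    ∃ C : ℝ, 0 ≤ C ∧ ∀ x : EuclideanSpace ℝ (Fin d), x ≠ 0 → ‖x‖ ≤ 1 →
      |(∫ y in (Metric.ball x (‖x‖ / 2))ᶜ, J p (u y) * (‖x - y‖ ^ ((d : ℝ) + s * p))⁻¹)
        - ∫ y, (binomialPoly (((d : ℝ) + s * p) / 2) N).eval (tau x (sphereInv y))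
          * tailDensity s p u y| ≤ C * ‖x‖ ^ N := by
  set κ := (d : ℝ) + s * p
  have hκ : 0 < κ := by positivity
  obtain ⟨C₁, hC₁, h1⟩ := exists_kernel_remainder_le (d := d) (half_pos hκ) N
  obtain ⟨C₂, hC₂, h2⟩ := exists_abs_eval_binomialPoly_tau_le (d := d) (κ / 2) N
  rw [mul_div_cancel₀ κ two_ne_zero] at h1
  set W : EuclideanSpace ℝ (Fin d) → ℝ := fun y =>
    (‖sphereInv y‖ ^ N + ‖sphereInv y‖ ^ (2 * N)) * |tailDensity s p u y|
  have hW : Integrable W := by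
    refine ((hω N).abs.add (hω (2 * N)).abs).congr (ae_of_all _ fun y => ?_)
    simp [W, abs_mul, add_mul]
  have hW0 : ∀ y, 0 ≤ W y := fun y => by positivity
  set I := ∫ y, W y
  have hI : 0 ≤ I := integral_nonneg hW0
  refine ⟨(C₁ + C₂) * I, by positivity, fun x hx hx1 => ?_⟩
  have hx0 := norm_pos_iff.2 hx
  have hA : MeasurableSet (Metric.ball x (‖x‖ / 2))ᶜ := measurableSet_ball.compl
  have hP := integrable_eval_tau_mul measurable_sphereInv hω (binomialPoly (κ / 2) N) x
  rw [← integral_indicator hA,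
    ← integral_sub ((integrableOn_far hs hp hu hx hx1).integrable_indicator hA) hP]
  calc _ ≤ ∫ y, (C₁ + C₂) * ‖x‖ ^ N * W y := by
        rw [← Real.norm_eq_abs]
        refine norm_integral_le_of_norm_le (hW.const_mul _) ?_
        filter_upwards [ae_ne_zero hd] with y hy
        have hw : J p (u y) * (‖y‖ ^ κ)⁻¹ = tailDensity s p u y := by
          rw [tailDensity, div_eq_mul_inv]
        have hw' : |J p (u y)| * (‖y‖ ^ κ)⁻¹ = |tailDensity s p u y| := by
          rw [← hw, abs_mul, abs_of_nonneg (by positivity : 0 ≤ (‖y‖ ^ κ)⁻¹)]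
        by_cases hxy : ‖x‖ / 2 ≤ ‖x - y‖
        · have hmem : y ∈ (Metric.ball x (‖x‖ / 2))ᶜ := by
            rw [Set.mem_compl_iff, mem_ball_iff_norm', not_lt]
            exact hxy
          rw [Set.indicator_of_mem hmem, ← hw, Real.norm_eq_abs]
          have h3 := h1 x y hx1 hy hxy
          calc |J p (u y) * (‖x - y‖ ^ κ)⁻¹ - (binomialPoly (κ / 2) N).eval (tau x (sphereInv y))
                * (J p (u y) * (‖y‖ ^ κ)⁻¹)|
              = |J p (u y)| * |(‖x - y‖ ^ κ)⁻¹ - (‖y‖ ^ κ)⁻¹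
                * (binomialPoly (κ / 2) N).eval (tau x (sphereInv y))| := by
                rw [← abs_mul]; congr 1; ring
            _ ≤ |J p (u y)| * (C₁ * ‖x‖ ^ N *
                ((‖sphereInv y‖ ^ N + ‖sphereInv y‖ ^ (2 * N)) * (‖y‖ ^ κ)⁻¹)) := by gcongr
            _ = C₁ * ‖x‖ ^ N * ((‖sphereInv y‖ ^ N + ‖sphereInv y‖ ^ (2 * N)) *
                (|J p (u y)| * (‖y‖ ^ κ)⁻¹)) := by ring
            _ = C₁ * ‖x‖ ^ N * W y := by rw [hw']
            _ ≤ _ := by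
                have := hW0 y
                gcongr
                linarith
        · have hmem : y ∉ (Metric.ball x (‖x‖ / 2))ᶜ := by
            rw [Set.mem_compl_iff, mem_ball_iff_norm', not_not]
            exact not_le.1 hxy
          rw [Set.indicator_of_notMem hmem, zero_sub, norm_neg, Real.norm_eq_abs, abs_mul]
          have h3 := h2 x y hx1 hy (not_le.1 hxy)
          calc _ ≤ C₂ * ‖x‖ ^ N * (‖sphereInv y‖ ^ N + ‖sphereInv y‖ ^ (2 * N))
                * |tailDensity s p u y| := by gcongr
            _ = C₂ * ‖x‖ ^ N * W y := by simp only [W]; ring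
            _ ≤ _ := by
                have := hW0 y
                gcongr
                linarith
    _ = _ := by rw [integral_const_mul]; ring

end FarPart

/-! ### Assembling the proof -/

section Conclusion

variable {d : ℕ} {s p : ℝ} {u f : EuclideanSpace ℝ (Fin d) → ℝ}
  {V : EuclideanSpace ℝ (Fin d) → ℝ → ℝ} {Ω : Set (EuclideanSpace ℝ (Fin d))}

/-- The right-hand side of the equation vanishes to infinite order at the origin. -/
theorem exists_rhs_le (hd : 0 < d) (hΩ : IsOpen Ω) (h0 : (0 : EuclideanSpace ℝ (Fin d)) ∈ Ω)
    (hf0 : ∀ n : ℕ, f =O[𝓝 0 ⊓ ae volume] fun x => ‖x‖ ^ n)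
    (hV : ∃ (ε₀ : ℝ) (n₀ : ℕ) (C : ℝ), 0 < ε₀ ∧
      ∀ᵐ x ∂(volume.restrict Ω), ∀ t : ℝ, ‖x‖ ^ n₀ * |V x t| ≤ C * |t| ^ ε₀)
    {ρ' : ℝ} (hρ0 : 0 < ρ')
    (hflat : ∀ N : ℕ, ∃ C : ℝ, 0 ≤ C ∧
      ∀ x : EuclideanSpace ℝ (Fin d), x ≠ 0 → ‖x‖ < ρ' → |u x| ≤ C * ‖x‖ ^ N) (N : ℕ) :
    ∃ C ρ : ℝ, 0 < ρ ∧ ∀ᵐ x : EuclideanSpace ℝ (Fin d), ‖x‖ < ρ →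
      x ∈ Ω ∧ |V x (u x) + f x| ≤ C * ‖x‖ ^ N := by
  obtain ⟨ε₀, n₀, C₀, hε₀, hV⟩ := hV
  obtain ⟨C₁, hC₁⟩ := (hf0 N).bound
  rw [eventually_iff, mem_inf_iff] at hC₁
  obtain ⟨A, hA, B, hB, hAB⟩ := hC₁
  obtain ⟨r, hr, hball⟩ := Metric.mem_nhds_iff.1 (inter_mem hA (hΩ.mem_nhds h0))
  -- Then |u|^ε₀ is O(|x|^(N + n₀)), which pays for the weight |x|^n₀ in front of V.
  set M := ⌈((N : ℝ) + n₀) / ε₀⌉₊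
  have hM : (N : ℝ) + n₀ ≤ M * ε₀ := by
    have := Nat.le_ceil (((N : ℝ) + n₀) / ε₀)
    rwa [div_le_iff₀ hε₀] at this
  obtain ⟨C₂, hC₂, hflat⟩ := hflat M
  refine ⟨|C₀| * C₂ ^ ε₀ + C₁, min (min r ρ') 1, by positivity, ?_⟩
  filter_upwards [(ae_restrict_iff' hΩ.measurableSet).1 hV, hB, ae_ne_zero hd] with x hxV hxB hx hxρ
  rw [lt_min_iff, lt_min_iff] at hxρ
  obtain ⟨⟨hxr, hxρ'⟩, hx1⟩ := hxρ
  obtain ⟨hxA, hxΩ⟩ := hball (mem_ball_zero_iff.2 hxr)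
  refine ⟨hxΩ, ?_⟩
  have hx0 := norm_pos_iff.2 hx
  have hfx : |f x| ≤ C₁ * ‖x‖ ^ N := by
    have : x ∈ A ∩ B := ⟨hxA, hxB⟩
    rw [← hAB] at this
    simpa using this
  have hux : |u x| ^ ε₀ ≤ C₂ ^ ε₀ * (‖x‖ ^ N * ‖x‖ ^ n₀) := by
    refine (Real.rpow_le_rpow (abs_nonneg _) (hflat x hx hxρ') hε₀.le).trans ?_
    rw [Real.mul_rpow hC₂ (by positivity), ← Real.rpow_natCast, ← Real.rpow_mul hx0.le,
      ← pow_add, ← Real.rpow_natCast, Nat.cast_add]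
    exact mul_le_mul_of_nonneg_left (Real.rpow_le_rpow_of_exponent_ge hx0 hx1.le hM)
      (by positivity)
  have hVx : |V x (u x)| ≤ |C₀| * C₂ ^ ε₀ * ‖x‖ ^ N := by
    have hn : 0 < ‖x‖ ^ n₀ := by positivity
    refine le_of_mul_le_mul_left ((hxV hxΩ (u x)).trans ?_) hn
    calc C₀ * |u x| ^ ε₀ ≤ |C₀| * (C₂ ^ ε₀ * (‖x‖ ^ N * ‖x‖ ^ n₀)) := by
          gcongr
          exact le_abs_self C₀
      _ = _ := by ring
  calc |V x (u x) + f x| ≤ |V x (u x)| + |f x| := abs_add_le _ _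
    _ ≤ _ := by linarith

/-- The moments of the tail density against all polynomials vanish. -/
theorem integral_eval_mul_tailDensity_eq_zero (hd : 0 < d) (hs : 0 < s) (hp : 1 < p)
    (hu : MemTailSpace s p u)
    (hω : ∀ n : ℕ, Integrable fun y => ‖sphereInv y‖ ^ n * tailDensity s p u y)
    {ρ ρ' : ℝ} (hρ : ρ ≤ 1) (hρ0 : 0 < ρ') (hρ' : ρ' ≤ ρ / 2) (hreg : LocalRegularity s p u ρ)
    (hflat : ∀ N : ℕ, ∃ C : ℝ, 0 ≤ C ∧
      ∀ x : EuclideanSpace ℝ (Fin d), x ≠ 0 → ‖x‖ < ρ' → |u x| ≤ C * ‖x‖ ^ N)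
    (heq : ∀ N : ℕ, ∃ C ρ : ℝ, 0 < ρ ∧ ∀ᵐ x : EuclideanSpace ℝ (Fin d), ‖x‖ < ρ →
      ∃ L : ℝ, HasFracPLaplacianAt s p u x L ∧ |L| ≤ C * ‖x‖ ^ N)
    (q : MvPolynomial (Fin d) ℝ) :
    ∫ y, MvPolynomial.eval (fun i => sphereInv y i) q * tailDensity s p u y = 0 := by
  have hsp : 0 < s * p := by positivity
  refine integral_eval_mul_eq_zero_of_flat measurable_sphereInv hω
    (r := ((d : ℝ) + s * p) / 2) (by positivity) (by linarith) (fun N => ?_) q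
  obtain ⟨C₁, ρ₁, hρ₁, h1⟩ := heq N
  obtain ⟨C₂, -, h2⟩ := exists_near_part_le hd hs hp hρ hρ' hreg hflat N
  obtain ⟨C₃, ρ₃, -, hρ₃, h3⟩ := exists_far_part_le hs hp hu hρ0 (by linarith) hflat N
  obtain ⟨C₄, -, h4⟩ := exists_expansion_le hd hs hp hu hω N
  refine ⟨C₁ + C₂ + C₃ + C₄, min (min ρ₁ ρ₃) (ρ' / 2),
    lt_min (lt_min hρ₁ hρ₃) (by positivity), ?_⟩
  filter_upwards [h1, ae_ne_zero hd] with x hx1 hx hxρ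
  rw [lt_min_iff, lt_min_iff] at hxρ
  obtain ⟨⟨hxρ₁, hxρ₃⟩, hxρ'⟩ := hxρ
  obtain ⟨L, hL, hLx⟩ := hx1 hxρ₁
  have h2 := h2 x hx hxρ' L hL
  have h3 := h3 x hx hxρ₃ (hL.1 _ (by have := norm_pos_iff.2 hx; positivity))
  have h4 := h4 x hx (by linarith)
  rw [abs_le] at *
  constructor <;> linarith [h2.1, h2.2, h3.1, h3.2, h4.1, h4.2, hLx.1, hLx.2]

theorem ae_eq_zero_of_isStrongSolution (hd : 0 < d) (hs : 0 < s) (hp : 1 < p)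
    (hΩ : IsOpen Ω) (h0 : (0 : EuclideanSpace ℝ (Fin d)) ∈ Ω)
    (hf0 : ∀ n : ℕ, f =O[𝓝 0 ⊓ ae volume] fun x => ‖x‖ ^ n)
    (hV : ∃ (ε₀ : ℝ) (n₀ : ℕ) (C : ℝ), 0 < ε₀ ∧
      ∀ᵐ x ∂(volume.restrict Ω), ∀ t : ℝ, ‖x‖ ^ n₀ * |V x t| ≤ C * |t| ^ ε₀)
    {ρ : ℝ} (hρ : 0 < ρ) (hρ1 : ρ ≤ 1) (hreg : LocalRegularity s p u ρ)
    (hu : IsStrongSolution s p V f u Ω) (hm : CarlemanCondition s p u) : u =ᵐ[volume] 0 := by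
  by_cases hpos : ∀ i k, moment s p u i k ≠ 0
  · have hω := integrable_norm_pow_mul_tailDensity hs hp hu.1 hm hpos
    obtain ⟨ρ', hρ0, hρ', hflat⟩ := exists_flat hs hp hρ hρ1 hreg hω
    have hq := integral_eval_mul_tailDensity_eq_zero hd hs hp hu.1 hω hρ1 hρ0 hρ' hreg hflat
      fun N => by
        obtain ⟨C, r, hr, h⟩ := exists_rhs_le hd hΩ h0 hf0 hV hρ0 hflat N
        refine ⟨C, r, hr, h.mono fun x hx hxr => ?_⟩
        obtain ⟨hxΩ, hx⟩ := hx hxr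
        obtain ⟨L, hL, hLx⟩ := hu.2 x hxΩ
        exact ⟨L, hL, by rwa [sub_eq_iff_eq_add'.1 hLx]⟩
    have hcar := carleman_integrals hs hp hu.1 hm hpos
    have := ae_eq_zero_of_carleman measurable_sphereInv measurable_sphereInv sphereInv_sphereInv
      hω (fun i => (hcar i).1) (fun i => (hcar i).2) hq
    filter_upwards [this, ae_ne_zero hd] with y hy hy0
    exact eq_zero_of_tailDensity_eq_zero hp hy0 hy
  · push Not at hpos
    obtain ⟨i, k, h⟩ := hpos
    exact ae_eq_zero_of_moment_eq_zero hp hu.1.1 h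

end Conclusion

end FracPLap

theorem theorem1p1 {d : ℕ} (hd : 0 < d) (s p : ℝ) (hs0 : 0 < s) (hs1 : s < 1) (hp : 1 < p)
    (Ω : Set (EuclideanSpace ℝ (Fin d))) (hΩ : IsOpen Ω) (h0 : (0 : EuclideanSpace ℝ (Fin d)) ∈ Ω)
    (f : EuclideanSpace ℝ (Fin d) → ℝ) (hf : MemLp f ∞ (volume.restrict Ω))
    (hf0 : ∀ n : ℕ, f =O[𝓝 0 ⊓ ae volume] fun x => ‖x‖ ^ n)
    (V : EuclideanSpace ℝ (Fin d) → ℝ → ℝ)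
    (hV : ∃ (ε₀ : ℝ) (n₀ : ℕ) (C : ℝ), 0 < ε₀ ∧
      ∀ᵐ x ∂(volume.restrict Ω), ∀ t : ℝ, ‖x‖ ^ n₀ * |V x t| ≤ C * |t| ^ ε₀)
    (u : EuclideanSpace ℝ (Fin d) → ℝ)
    (hreg :
      (2 ≤ p ∧ ∃ α : ℝ, 0 ≤ α ∧ α ≤ 1 ∧ 1 - (1 - s) * p < α ∧ FracPLap.MemHolderLoc 1 α u Ω) ∨
      (∃ β : ℝ, s * (p / (p - 1)) < β ∧ β ≤ 1 ∧ FracPLap.MemHolderLoc 0 β u Ω) ∨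
      (p ≤ 2 ∧ ∃ β : ℝ, s * (p / (p - 1)) < β ∧ β < 2 ∧
        FracPLap.MemHolderLoc ⌊β⌋₊ (β - ⌊β⌋₊) u Ω))
    (hu : FracPLap.IsStrongSolution s p V f u Ω)
    (hm : FracPLap.CarlemanCondition s p u) :
    u =ᵐ[volume] 0 ∧ ∀ x ∈ Ω, u x = 0 := by
  obtain ⟨ρ, hρ, hρ1, -, hlocal⟩ := FracPLap.exists_localRegularity hs0 hp hΩ h0 hreg
  have h := FracPLap.ae_eq_zero_of_isStrongSolution hd hs0 hp hΩ h0 hf0 hV hρ hρ1 hlocal hu hm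
  -- u is continuous on the open set Ω, so vanishing a.e. there becomes vanishing everywhere.
  exact ⟨h, Measure.eqOn_open_of_ae_eq (ae_restrict_of_ae h) hΩ
    (FracPLap.continuousOn_of_regularity hreg) continuousOn_const⟩
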